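/- Let $\underline G=(G\rightrightarrows M)$ be a Lie groupoid, with $G$ and $M$ smooth finite-dimensional (Hausdorff, second countable) manifolds. A VB-groupoid $\underline\Gamma=(\Gamma\rightrightarrows E)$ over $\underline G$ consists of smooth vector bundles $\Gamma\to G$ and $E\to M$ of finite rank and a Lie groupoid structure $\Gamma\rightrightarrows E$ whose structure maps cover those of $\underline G$ and are fiberwise linear. A VB-map over $\underline G$ is a Lie groupoid map between VB-groupoids over $\underline G$ which covers the identity of $\underline G$ and is fiberwise linear. A Lie groupoid map $\phi:(H'\rightrightarrows N')\to(H\rightrightarrows N)$ is Morita if it is * fully faithful: the target and source maps exhibit $H'$ as a good fibered product $(N'\times N')\times_{N\times N}H$, i.e. $h\mapsto(t(h),s(h),\phi(h))$ is a homeomorphism onto the set-theoretic fibered product, and at every $h\in H'$ it identifies $T_hH'$ with the fibered product of the tangent spaces $T_{t(h)}N'\times T_{s(h)}N'$ and $T_{\phi(h)}H$ over $T_{t(\phi(h))}N\times T_{s(\phi(h))}N$; * essentially surjective: the map $H\times_N N'=\{(h,x): s(h)=\phi(x)\}\to N$, $(h,x)\mapsto t(h)$, is a surjective submersion. Given VB-maps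 $\phi,\psi:\underline\Gamma'=(\Gamma'\rightrightarrows E')\to\underline\Gamma=(\Gamma\rightrightarrows E)$ over $\underline G$, an isomorphism $\alpha:\phi\cong\psi$ over $\underline G$ is a smooth vector bundle map $\alpha:E'\to\Gamma|_M$ covering $\mathrm{id}_M$ (where $M\subset G$ via the units) such that $s\alpha(e)=\phi(e)$ and $t\alpha(e)=\psi(e)$ for all $e\in E'$, and $\psi(v)\alpha(e)=\alpha(e')\phi(v)$ for every arrow $v:e\to e'$ in $\underline\Gamma'$. A VB-map $\phi:\underline\Gamma'\to\underline\Gamma$ over $\underline G$ is an equivalence if there is a VB-map $\psi:\underline\Gamma\to\underline\Gamma'$ over $\underline G$ with $\psi\phi\cong\mathrm{id}_{\underline\Gamma'}$ and $\phi\psi\cong\mathrm{id}_{\underline\Gamma}$ over $\underline G$. **Proposition.** Let $\underline\Gamma'$ and $\underline\Gamma$ be VB-groupoids over $\underline G$. A VB-map $\phi:\underline\Gamma'\to\underline\Gamma$ over $\underline G$ is Morita (as a map of Lie groupoids $(\Gamma'\rightrightarrows E')\to(\Gamma\rightrightarrows E)$) if and only if it is an equivalence. -/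

import Mathlib

open Bundle Topology
open scoped Manifold ContDiff

/-! ### Lie groupoids -/

section Submersions

variable {E₁ : Type*} [NormedAddCommGroup E₁] [NormedSpace ℝ E₁]
  {H₁ : Type*} [TopologicalSpace H₁] (I₁ : ModelWithCorners ℝ E₁ H₁)
  {P : Type*} [TopologicalSpace P] [ChartedSpace H₁ P]
  {E₂ : Type*} [NormedAddCommGroup E₂] [NormedSpace ℝ E₂]
  {H₂ : Type*} [TopologicalSpace H₂] (I₂ : ModelWithCorners ℝ E₂ H₂)
  {A : Type*} [TopologicalSpace A] [ChartedSpace H₂ A]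
  {E₃ : Type*} [NormedAddCommGroup E₃] [NormedSpace ℝ E₃]
  {H₃ : Type*} [TopologicalSpace H₃] (I₃ : ModelWithCorners ℝ E₃ H₃)
  {B : Type*} [TopologicalSpace B] [ChartedSpace H₃ B]
  {E₄ : Type*} [NormedAddCommGroup E₄] [NormedSpace ℝ E₄]
  {H₄ : Type*} [TopologicalSpace H₄] (I₄ : ModelWithCorners ℝ E₄ H₄)
  {N : Type*} [TopologicalSpace N] [ChartedSpace H₄ N]

/-- Surjective submersions between (finite-dimensional, boundaryless) smooth manifolds: smooth
surjective maps whose differential is surjective at every point. -/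
structure IsSurjectiveSubmersion (f : P → A) : Prop where
  contMDiff : ContMDiff I₁ I₂ ∞ f
  surjective : Function.Surjective f
  surjective_mfderiv : ∀ x : P, Function.Surjective (mfderiv I₁ I₂ f x)

/-- For smooth maps `p : P → A`, `q : P → B`, `f : A → N`, `g : B → N`, the manifold `P` is a good
fibered product of `f` and `g` with projections `p` and `q`: the map `(p, q)` is a homeomorphism
onto the set-theoretic fibered product `{(a, b) | f a = g b}`, and for every `x : P` the sequence
`0 → T_x P → T_{p x} A × T_{q x} B → T_{f (p x)} N` is exact. -/
structure IsGoodFiberedProduct (p : P → A) (q : P → B) (f : A → N) (g : B → N) : Prop where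
  isEmbedding : IsEmbedding (fun x => (p x, q x))
  range_eq : Set.range (fun x => (p x, q x)) = {z : A × B | f z.1 = g z.2}
  tangent_injective : ∀ (x : P) (u : TangentSpace I₁ x),
    mfderiv I₁ I₂ p x u = 0 → mfderiv I₁ I₃ q x u = 0 → u = 0
  tangent_exact : ∀ (x : P) (a : TangentSpace I₂ (p x)) (b : TangentSpace I₃ (q x)),
    (mfderiv I₂ I₄ f (p x) a : E₄) = (mfderiv I₃ I₄ g (q x) b : E₄) ↔
      ∃ u : TangentSpace I₁ x, mfderiv I₁ I₂ p x u = a ∧ mfderiv I₁ I₃ q x u = b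

end Submersions

section LieGroupoids

variable {EG : Type*} [NormedAddCommGroup EG] [NormedSpace ℝ EG]
  {HG : Type*} [TopologicalSpace HG]
  {EM : Type*} [NormedAddCommGroup EM] [NormedSpace ℝ EM]
  {HM : Type*} [TopologicalSpace HM]

/-- A Lie groupoid `G ⇉ M` with manifold of arrows `G` and manifold of objects `M`. An arrow `g`
goes from `src g` to `tgt g`, and `mul g h` is the composite "`g` after `h`". The operation `mul`
is a function on all of `G × G` for convenience only: all that is required of it concerns the
composable pairs, `src g = tgt h`, and its values on other pairs carry no meaning. Since `src` and
`tgt` are submersions, the composable pairs form an embedded submanifold of `G × G`, and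
`ContMDiffOn` on it is smoothness on that submanifold. -/
structure LieGroupoid (I : ModelWithCorners ℝ EG HG) (J : ModelWithCorners ℝ EM HM)
    (G : Type*) [TopologicalSpace G] [ChartedSpace HG G]
    (M : Type*) [TopologicalSpace M] [ChartedSpace HM M] where
  src : G → M
  tgt : G → M
  mul : G → G → G
  one : M → G
  inv : G → G
  src_submersion : IsSurjectiveSubmersion I J src
  tgt_submersion : IsSurjectiveSubmersion I J tgt
  contMDiffOn_mul : ContMDiffOn (I.prod I) I ∞ (fun p : G × G => mul p.1 p.2)
    {p : G × G | src p.1 = tgt p.2}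
  contMDiff_one : ContMDiff J I ∞ one
  contMDiff_inv : ContMDiff I I ∞ inv
  src_one : ∀ x, src (one x) = x
  tgt_one : ∀ x, tgt (one x) = x
  src_mul : ∀ g h, src g = tgt h → src (mul g h) = src h
  tgt_mul : ∀ g h, src g = tgt h → tgt (mul g h) = tgt g
  src_inv : ∀ g, src (inv g) = tgt g
  tgt_inv : ∀ g, tgt (inv g) = src g
  mul_assoc : ∀ g h k, src g = tgt h → src h = tgt k → mul (mul g h) k = mul g (mul h k)
  mul_one : ∀ g, mul g (one (src g)) = g
  one_mul : ∀ g, mul (one (tgt g)) g = g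
  inv_mul : ∀ g, mul (inv g) g = one (src g)
  mul_inv : ∀ g, mul g (inv g) = one (tgt g)

variable {I : ModelWithCorners ℝ EG HG} {J : ModelWithCorners ℝ EM HM}
  {G : Type*} [TopologicalSpace G] [ChartedSpace HG G]
  {M : Type*} [TopologicalSpace M] [ChartedSpace HM M]
  {EG' : Type*} [NormedAddCommGroup EG'] [NormedSpace ℝ EG']
  {HG' : Type*} [TopologicalSpace HG'] {I' : ModelWithCorners ℝ EG' HG'}
  {EM' : Type*} [NormedAddCommGroup EM'] [NormedSpace ℝ EM']
  {HM' : Type*} [TopologicalSpace HM'] {J' : ModelWithCorners ℝ EM' HM'}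
  {G' : Type*} [TopologicalSpace G'] [ChartedSpace HG' G']
  {M' : Type*} [TopologicalSpace M'] [ChartedSpace HM' M']
  {EG'' : Type*} [NormedAddCommGroup EG''] [NormedSpace ℝ EG'']
  {HG'' : Type*} [TopologicalSpace HG''] {I'' : ModelWithCorners ℝ EG'' HG''}
  {EM'' : Type*} [NormedAddCommGroup EM''] [NormedSpace ℝ EM'']
  {HM'' : Type*} [TopologicalSpace HM''] {J'' : ModelWithCorners ℝ EM'' HM''}
  {G'' : Type*} [TopologicalSpace G''] [ChartedSpace HG'' G'']
  {M'' : Type*} [TopologicalSpace M''] [ChartedSpace HM'' M'']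

/-- A map of Lie groupoids: smooth maps on arrows and on objects that commute with the five
structure maps. -/
structure LieGroupoid.Map (𝒢 : LieGroupoid I J G M) (𝒢' : LieGroupoid I' J' G' M') where
  arr : G → G'
  obj : M → M'
  contMDiff_arr : ContMDiff I I' ∞ arr
  contMDiff_obj : ContMDiff J J' ∞ obj
  src_arr : ∀ g, 𝒢'.src (arr g) = obj (𝒢.src g)
  tgt_arr : ∀ g, 𝒢'.tgt (arr g) = obj (𝒢.tgt g)
  arr_mul : ∀ g h, 𝒢.src g = 𝒢.tgt h → arr (𝒢.mul g h) = 𝒢'.mul (arr g) (arr h)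
  arr_one : ∀ x, arr (𝒢.one x) = 𝒢'.one (obj x)
  arr_inv : ∀ g, arr (𝒢.inv g) = 𝒢'.inv (arr g)

/-- The identity map of a Lie groupoid. -/
def LieGroupoid.Map.id (𝒢 : LieGroupoid I J G M) : LieGroupoid.Map 𝒢 𝒢 where
  arr := fun g => g
  obj := fun x => x
  contMDiff_arr := contMDiff_id
  contMDiff_obj := contMDiff_id
  src_arr _ := rfl
  tgt_arr _ := rfl
  arr_mul _ _ _ := rfl
  arr_one _ := rfl
  arr_inv _ := rfl

/-- The composite "`ψ` after `φ`" of maps of Lie groupoids. -/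
def LieGroupoid.Map.comp {𝒢 : LieGroupoid I J G M} {𝒢' : LieGroupoid I' J' G' M'}
    {𝒢'' : LieGroupoid I'' J'' G'' M''} (ψ : LieGroupoid.Map 𝒢' 𝒢'')
    (φ : LieGroupoid.Map 𝒢 𝒢') : LieGroupoid.Map 𝒢 𝒢'' where
  arr := fun g => ψ.arr (φ.arr g)
  obj := fun x => ψ.obj (φ.obj x)
  contMDiff_arr := ψ.contMDiff_arr.comp φ.contMDiff_arr
  contMDiff_obj := ψ.contMDiff_obj.comp φ.contMDiff_obj
  src_arr g := by rw [ψ.src_arr, φ.src_arr]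
  tgt_arr g := by rw [ψ.tgt_arr, φ.tgt_arr]
  arr_mul g h hgh := by
    rw [φ.arr_mul g h hgh, ψ.arr_mul _ _ (by rw [φ.src_arr, φ.tgt_arr, hgh])]
  arr_one x := by rw [φ.arr_one, ψ.arr_one]
  arr_inv g := by rw [φ.arr_inv, ψ.arr_inv]

/-- `φ : (G ⇉ M) → (G' ⇉ M')` is fully faithful: target and source exhibit `G` as a good fibered
product `(M × M) ×_{M' × M'} G'`. -/
def LieGroupoid.Map.IsFullyFaithful {𝒢 : LieGroupoid I J G M} {𝒢' : LieGroupoid I' J' G' M'}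
    (φ : LieGroupoid.Map 𝒢 𝒢') : Prop :=
  IsGoodFiberedProduct I (J.prod J) I' (J'.prod J')
    (fun g : G => (𝒢.tgt g, 𝒢.src g)) φ.arr
    (Prod.map φ.obj φ.obj) (fun g' : G' => (𝒢'.tgt g', 𝒢'.src g'))

/-- `φ : (G ⇉ M) → (G' ⇉ M')` is essentially surjective: the map
`G' ×_{M'} M = {(g, x) | src g = φ x} → M'`, `(g, x) ↦ tgt g`, is a surjective submersion. As
`src` is a submersion, the fibered product is an embedded submanifold of `G' × M` whose tangent
space at `(g, x)` consists of the pairs `(u, v)` with `d src u = dφ v`. -/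
structure LieGroupoid.Map.IsEssentiallySurjective {𝒢 : LieGroupoid I J G M}
    {𝒢' : LieGroupoid I' J' G' M'} (φ : LieGroupoid.Map 𝒢 𝒢') : Prop where
  surjective : ∀ y : M', ∃ (g : G') (x : M), 𝒢'.src g = φ.obj x ∧ 𝒢'.tgt g = y
  submersion : ∀ (g : G') (x : M), 𝒢'.src g = φ.obj x → ∀ w : TangentSpace J' (𝒢'.tgt g),
    ∃ (u : TangentSpace I' g) (v : TangentSpace J x),
      (mfderiv I' J' 𝒢'.src g u : EM') = (mfderiv J J' φ.obj x v : EM') ∧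
      mfderiv I' J' 𝒢'.tgt g u = w

/-- Morita maps of Lie groupoids. -/
structure LieGroupoid.Map.IsMorita {𝒢 : LieGroupoid I J G M}
    {𝒢' : LieGroupoid I' J' G' M'} (φ : LieGroupoid.Map 𝒢 𝒢') : Prop where
  fullyFaithful : φ.IsFullyFaithful
  essentiallySurjective : φ.IsEssentiallySurjective

end LieGroupoids

/-! ### VB-groupoids -/

/-- A map `Φ` between total spaces of vector bundles covers `f` and is linear on the fibers. -/
def IsFiberwiseLinear {X Y : Type*} {F F' : Type*} {V : X → Type*} {W : Y → Type*}
    [∀ x, AddCommGroup (V x)] [∀ x, Module ℝ (V x)]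
    [∀ y, AddCommGroup (W y)] [∀ y, Module ℝ (W y)]
    (f : X → Y) (Φ : TotalSpace F V → TotalSpace F' W) : Prop :=
  ∀ x, ∃ L : V x →ₗ[ℝ] W (f x), ∀ v : V x, Φ ⟨x, v⟩ = ⟨f x, L v⟩

theorem isFiberwiseLinear_id {X F : Type*} {V : X → Type*}
    [∀ x, AddCommGroup (V x)] [∀ x, Module ℝ (V x)] :
    IsFiberwiseLinear (fun x : X => x) (fun v : TotalSpace F V => v) :=
  fun _ => ⟨LinearMap.id, fun _ => rfl⟩

theorem IsFiberwiseLinear.comp {X Y Z : Type*} {F F' F'' : Type*} {V : X → Type*} {W : Y → Type*}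
    {U : Z → Type*}
    [∀ x, AddCommGroup (V x)] [∀ x, Module ℝ (V x)]
    [∀ y, AddCommGroup (W y)] [∀ y, Module ℝ (W y)]
    [∀ z, AddCommGroup (U z)] [∀ z, Module ℝ (U z)]
    {f : X → Y} {g : Y → Z} {Φ : TotalSpace F V → TotalSpace F' W}
    {Ψ : TotalSpace F' W → TotalSpace F'' U}
    (hΨ : IsFiberwiseLinear g Ψ) (hΦ : IsFiberwiseLinear f Φ) :
    IsFiberwiseLinear (fun x => g (f x)) (fun v => Ψ (Φ v)) := by
  intro x
  obtain ⟨L, hL⟩ := hΦ x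
  obtain ⟨K, hK⟩ := hΨ (f x)
  exact ⟨K.comp L, fun v => by simp [hL, hK]⟩

section VBGroupoids

variable {EG : Type*} [NormedAddCommGroup EG] [NormedSpace ℝ EG]
  {HG : Type*} [TopologicalSpace HG] {I : ModelWithCorners ℝ EG HG}
  {EM : Type*} [NormedAddCommGroup EM] [NormedSpace ℝ EM]
  {HM : Type*} [TopologicalSpace HM] {J : ModelWithCorners ℝ EM HM}
  {G : Type*} [TopologicalSpace G] [ChartedSpace HG G]
  {M : Type*} [TopologicalSpace M] [ChartedSpace HM M]

/-- A VB-groupoid `Γ ⇉ E` over `G ⇉ M`, for smooth vector bundles `Γ → G` and `E → M` with model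
fibers `FΓ` and `FE`: a Lie groupoid structure on the total spaces `Γ ⇉ E` whose structure maps
cover those of `G ⇉ M` (so that the bundle projections form a map of Lie groupoids) and are linear
on the fibers. For the multiplication this means that the map from the space of composable pairs
in `Γ_g × Γ_h` to `Γ_{gh}` is linear, i.e. the restriction of a linear map on `Γ_g × Γ_h`. -/
structure VBGroupoid (𝒢 : LieGroupoid I J G M)
    (FΓ : Type*) [NormedAddCommGroup FΓ] [NormedSpace ℝ FΓ]
    (Γ : G → Type*) [∀ g, AddCommGroup (Γ g)] [∀ g, Module ℝ (Γ g)]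
    [∀ g, TopologicalSpace (Γ g)] [TopologicalSpace (TotalSpace FΓ Γ)]
    [FiberBundle FΓ Γ] [VectorBundle ℝ FΓ Γ] [ContMDiffVectorBundle ∞ FΓ Γ I]
    (FE : Type*) [NormedAddCommGroup FE] [NormedSpace ℝ FE]
    (E : M → Type*) [∀ x, AddCommGroup (E x)] [∀ x, Module ℝ (E x)]
    [∀ x, TopologicalSpace (E x)] [TopologicalSpace (TotalSpace FE E)]
    [FiberBundle FE E] [VectorBundle ℝ FE E] [ContMDiffVectorBundle ∞ FE E J]
    extends LieGroupoid (I.prod 𝓘(ℝ, FΓ)) (J.prod 𝓘(ℝ, FE)) (TotalSpace FΓ Γ) (TotalSpace FE E)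
    where
  linear_src : IsFiberwiseLinear 𝒢.src src
  linear_tgt : IsFiberwiseLinear 𝒢.tgt tgt
  linear_one : IsFiberwiseLinear 𝒢.one one
  linear_inv : IsFiberwiseLinear 𝒢.inv inv
  linear_mul : ∀ g h : G, 𝒢.src g = 𝒢.tgt h →
    ∃ L : Γ g × Γ h →ₗ[ℝ] Γ (𝒢.mul g h), ∀ (v : Γ g) (w : Γ h),
      src ⟨g, v⟩ = tgt ⟨h, w⟩ → mul ⟨g, v⟩ ⟨h, w⟩ = ⟨𝒢.mul g h, L (v, w)⟩

variable {𝒢 : LieGroupoid I J G M}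
  {FΓ : Type*} [NormedAddCommGroup FΓ] [NormedSpace ℝ FΓ]
  {Γ : G → Type*} [∀ g, AddCommGroup (Γ g)] [∀ g, Module ℝ (Γ g)]
  [∀ g, TopologicalSpace (Γ g)] [TopologicalSpace (TotalSpace FΓ Γ)]
  [FiberBundle FΓ Γ] [VectorBundle ℝ FΓ Γ] [ContMDiffVectorBundle ∞ FΓ Γ I]
  {FE : Type*} [NormedAddCommGroup FE] [NormedSpace ℝ FE]
  {E : M → Type*} [∀ x, AddCommGroup (E x)] [∀ x, Module ℝ (E x)]
  [∀ x, TopologicalSpace (E x)] [TopologicalSpace (TotalSpace FE E)]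
  [FiberBundle FE E] [VectorBundle ℝ FE E] [ContMDiffVectorBundle ∞ FE E J]
  {FΓ' : Type*} [NormedAddCommGroup FΓ'] [NormedSpace ℝ FΓ']
  {Γ' : G → Type*} [∀ g, AddCommGroup (Γ' g)] [∀ g, Module ℝ (Γ' g)]
  [∀ g, TopologicalSpace (Γ' g)] [TopologicalSpace (TotalSpace FΓ' Γ')]
  [FiberBundle FΓ' Γ'] [VectorBundle ℝ FΓ' Γ'] [ContMDiffVectorBundle ∞ FΓ' Γ' I]
  {FE' : Type*} [NormedAddCommGroup FE'] [NormedSpace ℝ FE']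
  {E' : M → Type*} [∀ x, AddCommGroup (E' x)] [∀ x, Module ℝ (E' x)]
  [∀ x, TopologicalSpace (E' x)] [TopologicalSpace (TotalSpace FE' E')]
  [FiberBundle FE' E'] [VectorBundle ℝ FE' E'] [ContMDiffVectorBundle ∞ FE' E' J]
  {FΓ'' : Type*} [NormedAddCommGroup FΓ''] [NormedSpace ℝ FΓ'']
  {Γ'' : G → Type*} [∀ g, AddCommGroup (Γ'' g)] [∀ g, Module ℝ (Γ'' g)]
  [∀ g, TopologicalSpace (Γ'' g)] [TopologicalSpace (TotalSpace FΓ'' Γ'')]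
  [FiberBundle FΓ'' Γ''] [VectorBundle ℝ FΓ'' Γ''] [ContMDiffVectorBundle ∞ FΓ'' Γ'' I]
  {FE'' : Type*} [NormedAddCommGroup FE''] [NormedSpace ℝ FE'']
  {E'' : M → Type*} [∀ x, AddCommGroup (E'' x)] [∀ x, Module ℝ (E'' x)]
  [∀ x, TopologicalSpace (E'' x)] [TopologicalSpace (TotalSpace FE'' E'')]
  [FiberBundle FE'' E''] [VectorBundle ℝ FE'' E''] [ContMDiffVectorBundle ∞ FE'' E'' J]

/-- A VB-map over the fixed base `G ⇉ M`: a map of Lie groupoids between the total groupoids that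
covers the identity of `G ⇉ M` and is linear on the fibers. -/
structure VBGroupoid.Map (𝒱 : VBGroupoid 𝒢 FΓ Γ FE E) (𝒱' : VBGroupoid 𝒢 FΓ' Γ' FE' E')
    extends LieGroupoid.Map 𝒱.toLieGroupoid 𝒱'.toLieGroupoid where
  linear_arr : IsFiberwiseLinear (fun g : G => g) arr
  linear_obj : IsFiberwiseLinear (fun x : M => x) obj

/-- The identity VB-map. -/
noncomputable def VBGroupoid.Map.id (𝒱 : VBGroupoid 𝒢 FΓ Γ FE E) : VBGroupoid.Map 𝒱 𝒱 where
  toMap := LieGroupoid.Map.id 𝒱.toLieGroupoid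
  linear_arr := isFiberwiseLinear_id
  linear_obj := isFiberwiseLinear_id

/-- The composite "`ψ` after `φ`" of VB-maps. -/
noncomputable def VBGroupoid.Map.comp {𝒱 : VBGroupoid 𝒢 FΓ Γ FE E} {𝒱' : VBGroupoid 𝒢 FΓ' Γ' FE' E'}
    {𝒱'' : VBGroupoid 𝒢 FΓ'' Γ'' FE'' E''} (ψ : VBGroupoid.Map 𝒱' 𝒱'')
    (φ : VBGroupoid.Map 𝒱 𝒱') : VBGroupoid.Map 𝒱 𝒱'' where
  toMap := LieGroupoid.Map.comp ψ.toMap φ.toMap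
  linear_arr := ψ.linear_arr.comp φ.linear_arr
  linear_obj := ψ.linear_obj.comp φ.linear_obj

/-- A VB-map is VB-Morita if the underlying map of total Lie groupoids is Morita. -/
def VBGroupoid.Map.IsVBMorita {𝒱 : VBGroupoid 𝒢 FΓ Γ FE E}
    {𝒱' : VBGroupoid 𝒢 FΓ' Γ' FE' E'} (φ : VBGroupoid.Map 𝒱 𝒱') : Prop :=
  φ.toMap.IsMorita

/-- An isomorphism `φ ≅ ψ` over `G ⇉ M` between VB-maps `(Γ ⇉ E) → (Γ' ⇉ E')`: a smooth vector
bundle map `E → Γ'|_M`, i.e. a smooth map into `Γ'` that is fiberwise linear over the units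
`M → G`, assigning to `e` an arrow from `φ e` to `ψ e`, naturally with respect to the arrows
of `Γ`. -/
structure VBGroupoid.Map.Iso {𝒱 : VBGroupoid 𝒢 FΓ Γ FE E}
    {𝒱' : VBGroupoid 𝒢 FΓ' Γ' FE' E'} (φ ψ : VBGroupoid.Map 𝒱 𝒱') where
  app : TotalSpace FE E → TotalSpace FΓ' Γ'
  contMDiff_app : ContMDiff (J.prod 𝓘(ℝ, FE)) (I.prod 𝓘(ℝ, FΓ')) ∞ app
  linear_app : IsFiberwiseLinear 𝒢.one app
  src_app : ∀ e, 𝒱'.src (app e) = φ.obj e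
  tgt_app : ∀ e, 𝒱'.tgt (app e) = ψ.obj e
  naturality : ∀ v : TotalSpace FΓ Γ,
    𝒱'.mul (ψ.arr v) (app (𝒱.src v)) = 𝒱'.mul (app (𝒱.tgt v)) (φ.arr v)

/-- A VB-map over `G ⇉ M` is an equivalence if it has a quasi-inverse: a VB-map over `G ⇉ M` in
the other direction that is inverse to it up to isomorphisms over `G ⇉ M`. -/
def VBGroupoid.Map.IsEquivalence {𝒱 : VBGroupoid 𝒢 FΓ Γ FE E}
    {𝒱' : VBGroupoid 𝒢 FΓ' Γ' FE' E'} (φ : VBGroupoid.Map 𝒱 𝒱') : Prop :=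
  ∃ ψ : VBGroupoid.Map 𝒱' 𝒱,
    Nonempty (VBGroupoid.Map.Iso (ψ.comp φ) (VBGroupoid.Map.id 𝒱)) ∧
    Nonempty (VBGroupoid.Map.Iso (φ.comp ψ) (VBGroupoid.Map.id 𝒱'))

end VBGroupoids

/-!
The two implications have proofs of different natures.

*Equivalences are Morita.* This holds for arbitrary Lie groupoids
(`LieGroupoid.Map.isMorita_of_isoId`). Given `α : ψ φ ≅ id` and `β : φ ψ ≅ id`, the arrow
`α(a) ψ(v) α(b)⁻¹` is the unique preimage under `φ`, with target `a` and source `b`, of an arrow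
`v : φ(b) → φ(a)`, and it depends smoothly on `(a, b, v)`. Essential surjectivity is witnessed by
the arrows `β(y) : φ(ψ(y)) → y`. The tangent conditions follow by differentiating the same
formulas. They involve maps, such as the multiplication, that are smooth only along an equalizer
`{f = g}`; since `df - dg` is surjective there, every vector tangent to the equalizer is the
velocity of a curve inside it, by the implicit function theorem, and the differentials can be
computed along such curves (`mfderiv_apply_of_eqOn_equalizer`).

*Morita VB-maps are equivalences.* At the unit of a zero object the essential surjectivity
of `φ : Γ' → Γ`, restricted to vertical vectors, says that every `e` in `E_x` is the target of an
arrow `v` in `Γ` over the unit at `x` whose source is `φ(e')` for some `e'` in `E'_x`. So the linear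
map `(v, e') ↦ (s v - φ e', t v)` is surjective over each unit; it has smooth linear right inverses
locally, and, the conditions being affine, a partition of unity on `M` glues them to smooth bundle
maps `σ : E → Γ|_M` and `τ : E → E'` with `σ(e) : φ(τ(e)) → e`
(`VBGroupoid.Map.exists_splitting`). Full faithfulness lifts smooth fiberwise linear families of
arrows from `Γ` to `Γ'` (`VBGroupoid.Map.exists_lift`): the lift is unique, and it is smooth because
target, source and `φ` are jointly injective on the fibers of `Γ'`, so that they have a smooth
left inverse in local trivializations. Lifting `v ↦ σ(t v)⁻¹ v σ(s v)` gives a quasi-inverse `ψ`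
with object map `τ`; then `σ` is an isomorphism `φ ψ ≅ id`, and the lift of `e' ↦ σ(φ(e'))` is an
isomorphism `ψ φ ≅ id`.

Fibers of a vector bundle over points that agree only propositionally are compared through the
coordinate `fiberCoord` in a preferred trivialization.
-/

/-! ### Curves in equalizers -/

/-- Every vector in the kernel of a surjective strict derivative is the velocity of a curve in the
level set. -/
theorem HasStrictFDerivAt.exists_curve_of_mem_ker
    {V : Type*} [NormedAddCommGroup V] [NormedSpace ℝ V] [FiniteDimensional ℝ V]
    {W : Type*} [NormedAddCommGroup W] [NormedSpace ℝ W] [FiniteDimensional ℝ W]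
    {F : V → W} {F' : V →L[ℝ] W} {a : V} (hF : HasStrictFDerivAt F F' a)
    (hsurj : Function.Surjective F') {ξ : V} (hξ : F' ξ = 0) :
    ∃ c : ℝ → V, c 0 = a ∧ HasFDerivAt c (ContinuousLinearMap.toSpanSingleton ℝ ξ) 0 ∧
      ∀ᶠ τ in 𝓝 (0 : ℝ), F (c τ) = F a := by
  have := FiniteDimensional.complete ℝ V
  have hr : F'.range = ⊤ := LinearMap.range_eq_top.2 hsurj
  let k : F'.ker := ⟨ξ, by simpa using hξ⟩
  let L : ℝ →L[ℝ] F'.ker := ContinuousLinearMap.toSpanSingleton ℝ k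
  refine ⟨fun τ => hF.implicitFunction F F' hr (F a) (L τ), ?_, ?_, ?_⟩
  · simp only [map_zero]
    exact hF.implicitFunction_apply_image hr
  · have h1 := (hF.to_implicitFunction hr).hasFDerivAt
    have h2 : HasFDerivAt (fun τ => L τ) L 0 := L.hasFDerivAt
    have h3 := HasFDerivAt.comp (0 : ℝ) (g := hF.implicitFunction F F' hr (F a))
      (f := fun τ => L τ) (by simpa using h1) h2
    refine h3.congr_fderiv ?_
    ext
    simp [L, k]
  · have h1 := hF.map_implicitFunction_eq hr
    have h2 : Filter.Tendsto (fun τ : ℝ => (F a, L τ)) (𝓝 0) (𝓝 (F a, 0)) := by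
      have : Continuous (fun τ : ℝ => (F a, L τ)) := by fun_prop
      simpa using this.tendsto 0
    exact h2.eventually h1

section Equalizers

variable {E₁ : Type*} [NormedAddCommGroup E₁] [NormedSpace ℝ E₁]
  {H₁ : Type*} [TopologicalSpace H₁] {I₁ : ModelWithCorners ℝ E₁ H₁}
  {P : Type*} [TopologicalSpace P] [ChartedSpace H₁ P]
  {E₂ : Type*} [NormedAddCommGroup E₂] [NormedSpace ℝ E₂]
  {H₂ : Type*} [TopologicalSpace H₂] {I₂ : ModelWithCorners ℝ E₂ H₂}
  {N : Type*} [TopologicalSpace N] [ChartedSpace H₂ N]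
  {E₃ : Type*} [NormedAddCommGroup E₃] [NormedSpace ℝ E₃]
  {H₃ : Type*} [TopologicalSpace H₃] {I₃ : ModelWithCorners ℝ E₃ H₃}
  {Q : Type*} [TopologicalSpace Q] [ChartedSpace H₃ Q]
  {E₄ : Type*} [NormedAddCommGroup E₄] [NormedSpace ℝ E₄]
  {H₄ : Type*} [TopologicalSpace H₄] {I₄ : ModelWithCorners ℝ E₄ H₄}
  {Z : Type*} [TopologicalSpace Z] [ChartedSpace H₄ Z]

variable (I₁ I₂) in
/-- The differential of `f` at `x`, regarded as a linear map between the model spaces. Differentials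
at points whose images agree only propositionally can then be compared and subtracted. -/
noncomputable def modelDeriv (f : P → N) (x : P) : E₁ →L[ℝ] E₂ :=
  mfderiv I₁ I₂ f x

theorem MDifferentiableAt.hasMFDerivAt_modelDeriv {f : P → N} {x : P}
    (hf : MDifferentiableAt I₁ I₂ f x) : 
    HasMFDerivAt I₁ I₂ f x (modelDeriv I₁ I₂ f x : E₁ →L[ℝ] E₂) :=
  hf.hasMFDerivAt

theorem HasMFDerivAt.modelDeriv_eq {f : P → N} {x : P} {D : E₁ →L[ℝ] E₂}
    (hf : HasMFDerivAt I₁ I₂ f x D) : modelDeriv I₁ I₂ f x = D :=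
  hf.mfderiv

/-- If `df - dg` is surjective at a point of the equalizer of `f` and `g`, then every vector `ξ`
with `df ξ = dg ξ` is the velocity of a curve in the equalizer. -/
theorem exists_curve_in_equalizer [I₁.Boundaryless] [FiniteDimensional ℝ E₁]
    [FiniteDimensional ℝ E₂]
    {f g : P → N} {p : P} (hf : ContMDiffAt I₁ I₂ ∞ f p) (hg : ContMDiffAt I₁ I₂ ∞ g p)
    (hfg : f p = g p)
    (hsurj : ∀ w : E₂, ∃ u : E₁, modelDeriv I₁ I₂ f p u - modelDeriv I₁ I₂ g p u = w)
    {ξ : E₁} (hξ : modelDeriv I₁ I₂ f p ξ = modelDeriv I₁ I₂ g p ξ) :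
    ∃ c : ℝ → P, c 0 = p ∧
      HasMFDerivAt 𝓘(ℝ, ℝ) I₁ c 0 (ContinuousLinearMap.toSpanSingleton ℝ ξ : ℝ →L[ℝ] E₁) ∧
      ∀ᶠ τ in 𝓝 (0 : ℝ), f (c τ) = g (c τ) := by
  let φ := extChartAt I₁ p
  -- `f` and `g` written in charts, in both cases with the chart at the common value `f p = g p`
  let f₀ : E₁ → E₂ := extChartAt I₂ (f p) ∘ f ∘ φ.symm
  let g₀ : E₁ → E₂ := extChartAt I₂ (f p) ∘ g ∘ φ.symm
  have key : ∀ h : P → N, ContMDiffAt I₁ I₂ ∞ h p →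
      HasStrictFDerivAt (extChartAt I₂ (h p) ∘ h ∘ φ.symm) (modelDeriv I₁ I₂ h p)
        (φ p) := by
    intro h hh
    have h1 := (contMDiffAt_iff.1 hh).2
    rw [I₁.range_eq_univ, contDiffWithinAt_univ] at h1
    have h2 := h1.hasStrictFDerivAt (by simp)
    have h3 : (modelDeriv I₁ I₂ h p)
        = fderiv ℝ (extChartAt I₂ (h p) ∘ h ∘ φ.symm) (φ p) := by
      have h4 : modelDeriv I₁ I₂ h p
          = fderivWithin ℝ (writtenInExtChartAt I₁ I₂ p h) (Set.range I₁) (φ p) :=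
        if_pos (hh.mdifferentiableAt (by simp))
      rw [h4, I₁.range_eq_univ, fderivWithin_univ]
      rfl
    rw [h3]
    exact h2
  have hf₀ : HasStrictFDerivAt f₀ (modelDeriv I₁ I₂ f p) (φ p) := key f hf
  have hg₀ : HasStrictFDerivAt g₀ (modelDeriv I₁ I₂ g p) (φ p) := by
    have := key g hg
    rwa [← hfg] at this
  have hφp : φ.symm (φ p) = p := extChartAt_to_inv p
  obtain ⟨c, hc0, hc, hce⟩ := (hf₀.sub hg₀).exists_curve_of_mem_ker
    (fun w => hsurj w) (ξ := ξ) (sub_eq_zero.2 hξ)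
  have hcc : ContinuousAt c 0 := hc.continuousAt
  have htarget : ∀ᶠ τ in 𝓝 (0 : ℝ), c τ ∈ φ.target :=
    hcc.eventually (by rw [hc0]; exact extChartAt_target_mem_nhds p)
  have hC0 : φ.symm (c 0) = p := by rw [hc0, hφp]
  have hCc : ContinuousAt (fun τ => φ.symm (c τ)) 0 := by
    refine ContinuousAt.comp (g := φ.symm) ?_ hcc
    rw [hc0]
    exact continuousAt_extChartAt_symm p
  refine ⟨fun τ => φ.symm (c τ), hC0, ⟨hCc, ?_⟩, ?_⟩
  · simp only [writtenInExtChartAt, extChartAt_model_space_eq_id, PartialEquiv.refl_symm,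
      PartialEquiv.refl_coe, Function.comp_id, modelWithCornersSelf_coe, Set.range_id,
      id, hC0]
    refine HasFDerivAt.hasFDerivWithinAt (hc.congr_of_eventuallyEq ?_)
    filter_upwards [htarget] with τ hτ
    exact φ.right_inv hτ
  · have hs : (extChartAt I₂ (f p)).source ∈ 𝓝 (f p) := extChartAt_source_mem_nhds _
    have e1 : ∀ᶠ τ in 𝓝 (0 : ℝ), f (φ.symm (c τ)) ∈ (extChartAt I₂ (f p)).source := by
      refine ContinuousAt.eventually_mem (f := fun τ => f (φ.symm (c τ)))
        (ContinuousAt.comp (g := f) ?_ hCc) ?_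
      · rw [hC0]; exact hf.continuousAt
      · simpa only [hC0] using hs
    have e2 : ∀ᶠ τ in 𝓝 (0 : ℝ), g (φ.symm (c τ)) ∈ (extChartAt I₂ (f p)).source := by
      refine ContinuousAt.eventually_mem (f := fun τ => g (φ.symm (c τ)))
        (ContinuousAt.comp (g := g) ?_ hCc) ?_
      · rw [hC0]; exact hg.continuousAt
      · simpa only [hC0, ← hfg] using hs
    filter_upwards [hce, e1, e2] with τ h h1 h2
    refine (extChartAt I₂ (f p)).injOn h1 h2 ?_
    have h0 : f₀ (φ p) - g₀ (φ p) = 0 := by simp [f₀, g₀, hφp, hfg]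
    have := h.trans h0
    exact sub_eq_zero.1 this

/-- Tangent calculus on an equalizer `S = {f = g}` cut out transversally: if `χ ∘ Ψ = θ` holds on
`S` only, the differentials still satisfy `dχ (dΨ ξ) = dθ ξ` for `ξ` tangent to `S`. -/
theorem mfderiv_apply_of_eqOn_equalizer [I₁.Boundaryless] [FiniteDimensional ℝ E₁]
    [FiniteDimensional ℝ E₂]
    {f g : P → N} {p : P} (hf : ContMDiffAt I₁ I₂ ∞ f p) (hg : ContMDiffAt I₁ I₂ ∞ g p)
    (hfg : f p = g p)
    (hsurj : ∀ w : E₂, ∃ u : E₁, modelDeriv I₁ I₂ f p u - modelDeriv I₁ I₂ g p u = w)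
    {ξ : E₁} (hξ : modelDeriv I₁ I₂ f p ξ = modelDeriv I₁ I₂ g p ξ)
    {Ψ : P → Q} {D : E₁ →L[ℝ] E₃} (hΨ : HasMFDerivWithinAt I₁ I₃ Ψ {x | f x = g x} p D)
    {χ : Q → Z} (hχ : MDifferentiableAt I₃ I₄ χ (Ψ p))
    {θ : P → Z} (hθ : MDifferentiableAt I₁ I₄ θ p) (heq : ∀ x, f x = g x → χ (Ψ x) = θ x) :
    modelDeriv I₃ I₄ χ (Ψ p) (D ξ) = modelDeriv I₁ I₄ θ p ξ := by
  obtain ⟨c, rfl, hc, hce⟩ := exists_curve_in_equalizer hf hg hfg hsurj hξ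
  have h1 : HasMFDerivAt 𝓘(ℝ, ℝ) I₃ (Ψ ∘ c) 0
      (D.comp (ContinuousLinearMap.toSpanSingleton ℝ ξ : ℝ →L[ℝ] E₁)) :=
    HasMFDerivWithinAt.hasMFDerivAt
      (hΨ.comp (s := {τ | f (c τ) = g (c τ)}) 0 hc.hasMFDerivWithinAt (fun _ h => h)) hce
  have h2 := HasMFDerivAt.comp (0 : ℝ) (g := χ) (f := Ψ ∘ c) hχ.hasMFDerivAt_modelDeriv h1
  have h3 := HasMFDerivAt.comp (0 : ℝ) (g := θ) (f := c) hθ.hasMFDerivAt_modelDeriv hc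
  have h4 := h2.congr_of_eventuallyEq (f₁ := θ ∘ c)
    (by filter_upwards [hce] with τ hτ using (heq _ hτ).symm)
  have h5 : (modelDeriv I₁ I₄ θ (c 0)).comp (ContinuousLinearMap.toSpanSingleton ℝ ξ) =
      (modelDeriv I₃ I₄ χ (Ψ (c 0))).comp (D.comp (ContinuousLinearMap.toSpanSingleton ℝ ξ)) :=
    hasMFDerivAt_unique h3 h4
  simpa using (congrArg (fun A : ℝ →L[ℝ] E₄ => A 1) h5).symm

end Equalizers

/-! ### Differentials between model spaces -/

section ModelDeriv

variable {E₁ : Type*} [NormedAddCommGroup E₁] [NormedSpace ℝ E₁]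
  {H₁ : Type*} [TopologicalSpace H₁] {I₁ : ModelWithCorners ℝ E₁ H₁}
  {P : Type*} [TopologicalSpace P] [ChartedSpace H₁ P]
  {E₂ : Type*} [NormedAddCommGroup E₂] [NormedSpace ℝ E₂]
  {H₂ : Type*} [TopologicalSpace H₂] {I₂ : ModelWithCorners ℝ E₂ H₂}
  {N : Type*} [TopologicalSpace N] [ChartedSpace H₂ N]
  {E₃ : Type*} [NormedAddCommGroup E₃] [NormedSpace ℝ E₃]
  {H₃ : Type*} [TopologicalSpace H₃] {I₃ : ModelWithCorners ℝ E₃ H₃}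
  {Q : Type*} [TopologicalSpace Q] [ChartedSpace H₃ Q]

theorem modelDeriv_comp {g : N → Q} {f : P → N} {x : P}
    (hg : MDifferentiableAt I₂ I₃ g (f x)) (hf : MDifferentiableAt I₁ I₂ f x) :
    modelDeriv I₁ I₃ (fun y => g (f y)) x
      = (modelDeriv I₂ I₃ g (f x)).comp (modelDeriv I₁ I₂ f x) :=
  (HasMFDerivAt.comp x (g := g) (f := f) hg.hasMFDerivAt_modelDeriv
    hf.hasMFDerivAt_modelDeriv).modelDeriv_eq

theorem modelDeriv_prodMk {f : P → N} {g : P → Q} {x : P}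
    (hf : MDifferentiableAt I₁ I₂ f x) (hg : MDifferentiableAt I₁ I₃ g x) :
    modelDeriv I₁ (I₂.prod I₃) (fun y => (f y, g y)) x
      = (modelDeriv I₁ I₂ f x).prod (modelDeriv I₁ I₃ g x) :=
  (hf.hasMFDerivAt_modelDeriv.prodMk hg.hasMFDerivAt_modelDeriv).modelDeriv_eq

theorem modelDeriv_fst (x : P × N) :
    modelDeriv (I₁.prod I₂) I₁ (Prod.fst : P × N → P) x = ContinuousLinearMap.fst ℝ E₁ E₂ :=
  (hasMFDerivAt_fst (I := I₁) (I' := I₂) x).modelDeriv_eq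

theorem modelDeriv_snd (x : P × N) :
    modelDeriv (I₁.prod I₂) I₂ (Prod.snd : P × N → N) x = ContinuousLinearMap.snd ℝ E₁ E₂ :=
  (hasMFDerivAt_snd (I := I₁) (I' := I₂) x).modelDeriv_eq

theorem modelDeriv_comp_fst {f : P → Q} {x : P × N} (hf : MDifferentiableAt I₁ I₃ f x.1) :
    modelDeriv (I₁.prod I₂) I₃ (fun y : P × N => f y.1) x
      = (modelDeriv I₁ I₃ f x.1).comp (ContinuousLinearMap.fst ℝ E₁ E₂) := by
  rw [modelDeriv_comp (f := Prod.fst) hf mdifferentiableAt_fst, modelDeriv_fst]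

theorem modelDeriv_comp_snd {f : N → Q} {x : P × N} (hf : MDifferentiableAt I₂ I₃ f x.2) :
    modelDeriv (I₁.prod I₂) I₃ (fun y : P × N => f y.2) x
      = (modelDeriv I₂ I₃ f x.2).comp (ContinuousLinearMap.snd ℝ E₁ E₂) := by
  rw [modelDeriv_comp (f := Prod.snd) hf mdifferentiableAt_snd, modelDeriv_snd]

end ModelDeriv

/-! ### Equivalences of Lie groupoids are Morita maps -/

section LieGroupoids

variable {EG : Type*} [NormedAddCommGroup EG] [NormedSpace ℝ EG]
  {HG : Type*} [TopologicalSpace HG]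
  {EM : Type*} [NormedAddCommGroup EM] [NormedSpace ℝ EM]
  {HM : Type*} [TopologicalSpace HM]
  {I : ModelWithCorners ℝ EG HG} {J : ModelWithCorners ℝ EM HM}
  {G : Type*} [TopologicalSpace G] [ChartedSpace HG G]
  {M : Type*} [TopologicalSpace M] [ChartedSpace HM M]
  {EG' : Type*} [NormedAddCommGroup EG'] [NormedSpace ℝ EG']
  {HG' : Type*} [TopologicalSpace HG'] {I' : ModelWithCorners ℝ EG' HG'}
  {EM' : Type*} [NormedAddCommGroup EM'] [NormedSpace ℝ EM']
  {HM' : Type*} [TopologicalSpace HM'] {J' : ModelWithCorners ℝ EM' HM'}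
  {G' : Type*} [TopologicalSpace G'] [ChartedSpace HG' G']
  {M' : Type*} [TopologicalSpace M'] [ChartedSpace HM' M']
  {EX : Type*} [NormedAddCommGroup EX] [NormedSpace ℝ EX]
  {HX : Type*} [TopologicalSpace HX] {IX : ModelWithCorners ℝ EX HX}
  {X : Type*} [TopologicalSpace X] [ChartedSpace HX X]

namespace LieGroupoid

variable (𝒢 : LieGroupoid I J G M)

theorem inv_mul_cancel_left {g h : G} (hgh : 𝒢.src g = 𝒢.tgt h) :
    𝒢.mul (𝒢.inv g) (𝒢.mul g h) = h := by
  rw [← 𝒢.mul_assoc _ _ _ (𝒢.src_inv g) hgh, 𝒢.inv_mul, hgh, 𝒢.one_mul]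

theorem mul_inv_cancel_left {g h : G} (hgh : 𝒢.tgt g = 𝒢.tgt h) :
    𝒢.mul g (𝒢.mul (𝒢.inv g) h) = h := by
  rw [← 𝒢.mul_assoc _ _ _ (𝒢.tgt_inv g).symm (by rw [𝒢.src_inv, hgh]), 𝒢.mul_inv, hgh, 𝒢.one_mul]

theorem mul_inv_cancel_right {g h : G} (hgh : 𝒢.src g = 𝒢.tgt h) :
    𝒢.mul (𝒢.mul g h) (𝒢.inv h) = g := by
  rw [𝒢.mul_assoc _ _ _ hgh (𝒢.tgt_inv h).symm, 𝒢.mul_inv, ← hgh, 𝒢.mul_one]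

theorem inv_mul_cancel_right {g h : G} (hgh : 𝒢.src g = 𝒢.src h) :
    𝒢.mul (𝒢.mul g (𝒢.inv h)) h = g := by
  rw [𝒢.mul_assoc _ _ _ (by rw [hgh, 𝒢.tgt_inv]) (𝒢.src_inv h), 𝒢.inv_mul, ← hgh, 𝒢.mul_one]

theorem mul_left_cancel {g h k : G} (hgh : 𝒢.src g = 𝒢.tgt h) (hgk : 𝒢.src g = 𝒢.tgt k)
    (heq : 𝒢.mul g h = 𝒢.mul g k) : h = k := by
  rw [← 𝒢.inv_mul_cancel_left hgh, heq, 𝒢.inv_mul_cancel_left hgk]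

theorem mul_right_cancel {g h k : G} (hgk : 𝒢.src g = 𝒢.tgt k) (hhk : 𝒢.src h = 𝒢.tgt k)
    (heq : 𝒢.mul g k = 𝒢.mul h k) : g = h := by
  rw [← 𝒢.mul_inv_cancel_right hgk, heq, 𝒢.mul_inv_cancel_right hhk]

theorem contMDiffOn_mul_comp {s : Set X} {a b : X → G} (ha : ContMDiffOn IX I ∞ a s)
    (hb : ContMDiffOn IX I ∞ b s) (hab : ∀ x ∈ s, 𝒢.src (a x) = 𝒢.tgt (b x)) :
    ContMDiffOn IX I ∞ (fun x => 𝒢.mul (a x) (b x)) s :=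
  𝒢.contMDiffOn_mul.comp (ha.prodMk hb) hab

theorem contMDiff_mul_comp {a b : X → G} (ha : ContMDiff IX I ∞ a) (hb : ContMDiff IX I ∞ b)
    (hab : ∀ x, 𝒢.src (a x) = 𝒢.tgt (b x)) : ContMDiff IX I ∞ (fun x => 𝒢.mul (a x) (b x)) :=
  contMDiffOn_univ.1
    (𝒢.contMDiffOn_mul_comp ha.contMDiffOn hb.contMDiffOn fun x _ => hab x)

theorem surjective_modelDeriv_src (g : G) : Function.Surjective (modelDeriv I J 𝒢.src g) :=
  𝒢.src_submersion.surjective_mfderiv g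

theorem surjective_modelDeriv_tgt (g : G) : Function.Surjective (modelDeriv I J 𝒢.tgt g) :=
  𝒢.tgt_submersion.surjective_mfderiv g

end LieGroupoid

namespace LieGroupoid.Map

variable {𝒢 : LieGroupoid I J G M} {𝒢' : LieGroupoid I' J' G' M'}

/-- A smooth natural isomorphism from the endomorphism `χ` of a Lie groupoid to the identity. -/
structure IsoId (χ : LieGroupoid.Map 𝒢 𝒢) where
  app : M → G
  contMDiff_app : ContMDiff J I ∞ app
  src_app : ∀ x, 𝒢.src (app x) = χ.obj x
  tgt_app : ∀ x, 𝒢.tgt (app x) = x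
  naturality : ∀ g, 𝒢.mul g (app (𝒢.src g)) = 𝒢.mul (app (𝒢.tgt g)) (χ.arr g)

section Equivalence

variable {φ : LieGroupoid.Map 𝒢 𝒢'} {ψ : LieGroupoid.Map 𝒢' 𝒢}
  (α : IsoId (ψ.comp φ))

theorem IsoId.faithful (β : IsoId (φ.comp ψ)) {v w : G'}
    (hs : 𝒢'.src v = 𝒢'.src w) (ht : 𝒢'.tgt v = 𝒢'.tgt w)
    (h : ψ.arr v = ψ.arr w) : v = w := by
  have h1 := β.naturality v
  have h2 := β.naturality w
  rw [← hs, ← ht] at h2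
  refine 𝒢'.mul_right_cancel (k := β.app (𝒢'.src v)) (β.tgt_app _).symm
    (by rw [β.tgt_app, hs]) (h1.trans (Eq.trans ?_ h2.symm))
  simp only [LieGroupoid.Map.comp, h]

/-- The arrow `α(a) ψ(v) α(b)⁻¹ : b → a`, the candidate for a preimage under `φ` of the arrow
`v : φ(b) → φ(a)`. -/
def IsoId.conj (z : (M × M) × G') : G :=
  𝒢.mul (𝒢.mul (α.app z.1.1) (ψ.arr z.2)) (𝒢.inv (α.app z.1.2))

variable {a b : M} {v : G'}

theorem IsoId.src_app_eq (ha : φ.obj a = 𝒢'.tgt v) :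
    𝒢.src (α.app a) = 𝒢.tgt (ψ.arr v) := by
  rw [α.src_app, ψ.tgt_arr, ← ha]; rfl

theorem IsoId.src_mul_eq (ha : φ.obj a = 𝒢'.tgt v) (hb : φ.obj b = 𝒢'.src v) :
    𝒢.src (𝒢.mul (α.app a) (ψ.arr v)) = 𝒢.src (α.app b) := by
  rw [𝒢.src_mul _ _ (α.src_app_eq ha), ψ.src_arr, α.src_app, ← hb]; rfl

theorem IsoId.src_conj (ha : φ.obj a = 𝒢'.tgt v) (hb : φ.obj b = 𝒢'.src v) :
    𝒢.src (α.conj ((a, b), v)) = b := by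
  rw [IsoId.conj, 𝒢.src_mul _ _ (by rw [α.src_mul_eq ha hb, 𝒢.tgt_inv]), 𝒢.src_inv, α.tgt_app]

theorem IsoId.tgt_conj (ha : φ.obj a = 𝒢'.tgt v) (hb : φ.obj b = 𝒢'.src v) :
    𝒢.tgt (α.conj ((a, b), v)) = a := by
  rw [IsoId.conj, 𝒢.tgt_mul _ _ (by rw [α.src_mul_eq ha hb, 𝒢.tgt_inv]),
    𝒢.tgt_mul _ _ (α.src_app_eq ha), α.tgt_app]

theorem IsoId.arr_conj (β : IsoId (φ.comp ψ)) (ha : φ.obj a = 𝒢'.tgt v) (hb : φ.obj b = 𝒢'.src v) :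
    φ.arr (α.conj ((a, b), v)) = v := by
  refine β.faithful (by rw [φ.src_arr, α.src_conj ha hb, hb])
    (by rw [φ.tgt_arr, α.tgt_conj ha hb, ha]) ?_
  have h1 := α.naturality (α.conj ((a, b), v))
  rw [α.src_conj ha hb, α.tgt_conj ha hb, IsoId.conj,
    𝒢.inv_mul_cancel_right (α.src_mul_eq ha hb)] at h1
  refine (𝒢.mul_left_cancel (α.src_app_eq ha) ?_ h1).symm
  have h2 := (ψ.comp φ).tgt_arr (α.conj ((a, b), v))
  rw [α.tgt_conj ha hb] at h2
  rw [α.src_app]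
  exact h2.symm

theorem IsoId.conj_arr (h : G) : α.conj ((𝒢.tgt h, 𝒢.src h), φ.arr h) = h := by
  have h1 := α.naturality h
  have h2 : 𝒢.mul (α.app (𝒢.tgt h)) (ψ.arr (φ.arr h)) = 𝒢.mul h (α.app (𝒢.src h)) := h1.symm
  rw [IsoId.conj, h2, 𝒢.mul_inv_cancel_right (α.tgt_app _).symm]

theorem IsoId.contMDiffOn_conj :
    ContMDiffOn ((J.prod J).prod I') I ∞ α.conj
      {z | Prod.map φ.obj φ.obj z.1 = (𝒢'.tgt z.2, 𝒢'.src z.2)} := by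
  have h11 : ContMDiff ((J.prod J).prod I') J ∞ (fun z : (M × M) × G' => z.1.1) :=
    contMDiff_fst.comp contMDiff_fst
  have h12 : ContMDiff ((J.prod J).prod I') J ∞ (fun z : (M × M) × G' => z.1.2) :=
    contMDiff_snd.comp contMDiff_fst
  have h2 : ContMDiff ((J.prod J).prod I') I' ∞ (fun z : (M × M) × G' => z.2) := contMDiff_snd
  refine 𝒢.contMDiffOn_mul_comp (𝒢.contMDiffOn_mul_comp
    (α.contMDiff_app.comp h11).contMDiffOn (ψ.contMDiff_arr.comp h2).contMDiffOn ?_)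
    (𝒢.contMDiff_inv.comp (α.contMDiff_app.comp h12)).contMDiffOn ?_
  · rintro ⟨⟨a, b⟩, v⟩ hz
    exact α.src_app_eq (congrArg Prod.fst hz)
  · rintro ⟨⟨a, b⟩, v⟩ hz
    refine Eq.trans ?_ (𝒢.tgt_inv _).symm
    exact α.src_mul_eq (congrArg Prod.fst hz) (congrArg Prod.snd hz)

/-- At `(g, x)` with `src g = φ x`, write `g = β(y) φ(k)` with `y = tgt g`. A tangent vector `w` at
`y` is lifted by differentiating the product along `β` and along a lift of `dψ w` through `k`. -/
theorem isEssentiallySurjective_of_isoId [I'.Boundaryless] [FiniteDimensional ℝ EG']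
    [FiniteDimensional ℝ EM'] (α : IsoId (ψ.comp φ)) (β : IsoId (φ.comp ψ)) :
    φ.IsEssentiallySurjective where
  surjective y := ⟨β.app y, ψ.obj y, β.src_app y, β.tgt_app y⟩
  submersion g x hgx w := by
    obtain ⟨y, hy⟩ : ∃ y, y = 𝒢'.tgt g := ⟨_, rfl⟩
    have hβg : 𝒢'.src (𝒢'.inv (β.app y)) = 𝒢'.tgt g := by rw [𝒢'.src_inv, β.tgt_app, hy]
    have hk1 : φ.obj (ψ.obj y) = 𝒢'.tgt (𝒢'.mul (𝒢'.inv (β.app y)) g) := by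
      rw [𝒢'.tgt_mul _ _ hβg, 𝒢'.tgt_inv, β.src_app]; rfl
    have hk2 : φ.obj x = 𝒢'.src (𝒢'.mul (𝒢'.inv (β.app y)) g) := by
      rw [𝒢'.src_mul _ _ hβg, hgx]
    obtain ⟨k, hks, hkt, hkφ⟩ : ∃ k, 𝒢.src k = x ∧ 𝒢.tgt k = ψ.obj y ∧
        φ.arr k = 𝒢'.mul (𝒢'.inv (β.app y)) g :=
      ⟨_, α.src_conj hk1 hk2, α.tgt_conj hk1 hk2, α.arr_conj β hk1 hk2⟩
    have hcomp : 𝒢'.src (β.app y) = 𝒢'.tgt (φ.arr k) := by rw [β.src_app, φ.tgt_arr, hkt]; rfl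
    have hg : 𝒢'.mul (β.app y) (φ.arr k) = g := by
      rw [hkφ, 𝒢'.mul_inv_cancel_left (by rw [β.tgt_app, hy])]
    have hds : ∀ g, MDifferentiableAt I' J' 𝒢'.src g := fun g =>
      𝒢'.src_submersion.contMDiff.mdifferentiable (by simp) g
    have hdt : ∀ g, MDifferentiableAt I' J' 𝒢'.tgt g := fun g =>
      𝒢'.tgt_submersion.contMDiff.mdifferentiable (by simp) g
    have hdφ := φ.contMDiff_arr.mdifferentiable (by simp)
    have hdφ₀ := φ.contMDiff_obj.mdifferentiable (by simp)
    have hdψ₀ := ψ.contMDiff_obj.mdifferentiable (by simp)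
    have hdβ := β.contMDiff_app.mdifferentiable (by simp)
    have hds₀ := 𝒢.src_submersion.contMDiff.mdifferentiable (by simp)
    have hdt₀ := 𝒢.tgt_submersion.contMDiff.mdifferentiable (by simp)
    let w' : EM' := w
    obtain ⟨w₂, hw₂⟩ := 𝒢.surjective_modelDeriv_tgt k (modelDeriv J' J ψ.obj y w')
    let ξ : EG' × EG' := (modelDeriv J' I' β.app y w', modelDeriv I I' φ.arr k w₂)
    let p : G' × G' := (β.app y, φ.arr k)
    have hf : ContMDiff (I'.prod I') J' ∞ (fun z : G' × G' => 𝒢'.src z.1) :=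
      𝒢'.src_submersion.contMDiff.comp contMDiff_fst
    have hg' : ContMDiff (I'.prod I') J' ∞ (fun z : G' × G' => 𝒢'.tgt z.2) :=
      𝒢'.tgt_submersion.contMDiff.comp contMDiff_snd
    have hsurj : ∀ w : EM', ∃ u : EG' × EG',
        modelDeriv (I'.prod I') J' (fun z : G' × G' => 𝒢'.src z.1) p u
          - modelDeriv (I'.prod I') J' (fun z : G' × G' => 𝒢'.tgt z.2) p u = w := by
      intro w
      obtain ⟨u, hu⟩ := 𝒢'.surjective_modelDeriv_src (β.app y) w
      refine ⟨(u, 0), ?_⟩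
      rw [modelDeriv_comp_fst (f := 𝒢'.src) (hds _), modelDeriv_comp_snd (f := 𝒢'.tgt) (hdt _)]
      simp [p, hu]
    -- the two factors stay composable to first order
    have hξ : modelDeriv (I'.prod I') J' (fun z : G' × G' => 𝒢'.src z.1) p ξ
        = modelDeriv (I'.prod I') J' (fun z : G' × G' => 𝒢'.tgt z.2) p ξ := by
      rw [modelDeriv_comp_fst (f := 𝒢'.src) (hds _), modelDeriv_comp_snd (f := 𝒢'.tgt) (hdt _)]
      have e1 : (fun y => 𝒢'.src (β.app y)) = fun y => φ.obj (ψ.obj y) := funext β.src_app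
      have e2 := congrArg (fun f => modelDeriv J' J' f y) e1
      rw [modelDeriv_comp (hds _) (hdβ y), modelDeriv_comp (hdφ₀ _) (hdψ₀ y)] at e2
      have e3 : (fun h => 𝒢'.tgt (φ.arr h)) = fun h => φ.obj (𝒢.tgt h) := funext φ.tgt_arr
      have e4 := congrArg (fun f => modelDeriv I J' f k) e3
      rw [modelDeriv_comp (hdt _) (hdφ k), modelDeriv_comp (hdφ₀ _) (hdt₀ k)] at e4
      have e5 := congrArg (fun A : EM' →L[ℝ] EM' => A w') e2
      have e6 := congrArg (fun A : EG →L[ℝ] EM' => A w₂) e4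
      simp only [ContinuousLinearMap.comp_apply] at e5 e6
      simp only [ContinuousLinearMap.comp_apply, ContinuousLinearMap.coe_fst',
        ContinuousLinearMap.coe_snd', ξ, p]
      rw [e5, e6, hw₂, hkt]
    have hm := ((𝒢'.contMDiffOn_mul p hcomp).mdifferentiableWithinAt
      (by simp)).hasMFDerivWithinAt
    have r1 := mfderiv_apply_of_eqOn_equalizer hf.contMDiffAt hg'.contMDiffAt hcomp hsurj hξ hm
      (χ := 𝒢'.src) (hds _)
      (θ := fun z => 𝒢'.src z.2) ((hds _).comp p mdifferentiableAt_snd)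
      (fun z hz => 𝒢'.src_mul _ _ hz)
    have r2 := mfderiv_apply_of_eqOn_equalizer hf.contMDiffAt hg'.contMDiffAt hcomp hsurj hξ hm
      (χ := 𝒢'.tgt) (hdt _)
      (θ := fun z => 𝒢'.tgt z.1) ((hdt _).comp p mdifferentiableAt_fst)
      (fun z hz => 𝒢'.tgt_mul _ _ hz)
    rw [modelDeriv_comp_snd (f := 𝒢'.src) (hds _)] at r1
    rw [modelDeriv_comp_fst (f := 𝒢'.tgt) (hdt _)] at r2
    simp only [p, hg] at r1 r2
    refine ⟨_, (modelDeriv I J 𝒢.src k w₂ : EM), r1.trans ?_, r2.trans ?_⟩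
    · have e3 : (fun h => 𝒢'.src (φ.arr h)) = fun h => φ.obj (𝒢.src h) := funext φ.src_arr
      have e4 := congrArg (fun f => modelDeriv I J' f k) e3
      rw [modelDeriv_comp (hds _) (hdφ k), modelDeriv_comp (hdφ₀ _) (hds₀ k), hks] at e4
      exact congrArg (fun A : EG →L[ℝ] EM' => A w₂) e4
    · have e1 : (fun y => 𝒢'.tgt (β.app y)) = fun y => y := funext β.tgt_app
      have e2 := congrArg (fun f => modelDeriv J' J' f y) e1
      rw [modelDeriv_comp (hdt _) (hdβ y)] at e2
      have e3 : modelDeriv J' J' (fun y : M' => y) y = ContinuousLinearMap.id ℝ EM' :=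
        (hasMFDerivAt_id (I := J') y).modelDeriv_eq
      rw [e3] at e2
      exact congrArg (fun A : EM' →L[ℝ] EM' => A w') e2

/-- The map `(t, s, φ)` is inverted on the fibered product by `IsoId.conj`. As `φ` is essentially
surjective, the fibered product is cut out transversally, so the differential of `IsoId.conj` along
it inverts the differential of `(t, s, φ)`. -/
theorem isFullyFaithful_of_isoId [I'.Boundaryless] [J.Boundaryless] [FiniteDimensional ℝ EG']
    [FiniteDimensional ℝ EM] [FiniteDimensional ℝ EM']
    (α : IsoId (ψ.comp φ)) (β : IsoId (φ.comp ψ)) : φ.IsFullyFaithful := by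
  have hts : ContMDiff I (J.prod J) ∞ (fun g => (𝒢.tgt g, 𝒢.src g)) :=
    𝒢.tgt_submersion.contMDiff.prodMk 𝒢.src_submersion.contMDiff
  have hts' : ContMDiff I' (J'.prod J') ∞ (fun g => (𝒢'.tgt g, 𝒢'.src g)) :=
    𝒢'.tgt_submersion.contMDiff.prodMk 𝒢'.src_submersion.contMDiff
  have hφφ : ContMDiff (J.prod J) (J'.prod J') ∞ (Prod.map φ.obj φ.obj) :=
    φ.contMDiff_obj.prodMap φ.contMDiff_obj
  have hΘ : ContMDiff I ((J.prod J).prod I') ∞ (fun h => ((𝒢.tgt h, 𝒢.src h), φ.arr h)) :=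
    hts.prodMk φ.contMDiff_arr
  have hmem : ∀ h, ((𝒢.tgt h, 𝒢.src h), φ.arr h) ∈
      {z : (M × M) × G' | Prod.map φ.obj φ.obj z.1 = (𝒢'.tgt z.2, 𝒢'.src z.2)} := by
    intro h
    exact Prod.ext (φ.tgt_arr h).symm (φ.src_arr h).symm
  have hdts := fun h => hts.mdifferentiable (by simp) h
  have hdts' := fun h => hts'.mdifferentiable (by simp) h
  have hdφφ := fun h => hφφ.mdifferentiable (by simp) h
  have hdφ := fun h => φ.contMDiff_arr.mdifferentiable (by simp) h
  have hdφ₀ := fun h => φ.contMDiff_obj.mdifferentiable (by simp) h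
  have hdΘ := fun h => hΘ.mdifferentiable (by simp) h
  have hds := fun h => 𝒢'.src_submersion.contMDiff.mdifferentiable (by simp) h
  have hdt := fun h => 𝒢'.tgt_submersion.contMDiff.mdifferentiable (by simp) h
  have hconj : ∀ h, ∃ D : (EM × EM) × EG' →L[ℝ] EG,
      HasMFDerivWithinAt ((J.prod J).prod I') I α.conj
        {z | Prod.map φ.obj φ.obj z.1 = (𝒢'.tgt z.2, 𝒢'.src z.2)}
        ((𝒢.tgt h, 𝒢.src h), φ.arr h) D := fun h =>
    ⟨_, ((α.contMDiffOn_conj _ (hmem h)).mdifferentiableWithinAt (by simp)).hasMFDerivWithinAt⟩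
  refine ⟨?_, ?_, ?_, ?_⟩
  · have hinj : Function.Injective (fun h => ((𝒢.tgt h, 𝒢.src h), φ.arr h)) :=
      Function.LeftInverse.injective (g := α.conj) α.conj_arr
    refine ⟨isInducing_iff_nhds.2 fun x => le_antisymm
      (Filter.map_le_iff_le_comap.1 hΘ.continuous.continuousAt) ?_, hinj⟩
    have h1 := (α.contMDiffOn_conj.continuousOn _ (hmem x)).tendsto
    rw [α.conj_arr x] at h1
    have h2 : Filter.Tendsto (fun h => ((𝒢.tgt h, 𝒢.src h), φ.arr h))
        (Filter.comap (fun h => ((𝒢.tgt h, 𝒢.src h), φ.arr h))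
          (𝓝 ((𝒢.tgt x, 𝒢.src x), φ.arr x)))
        (𝓝[{z | Prod.map φ.obj φ.obj z.1 = (𝒢'.tgt z.2, 𝒢'.src z.2)}]
          ((𝒢.tgt x, 𝒢.src x), φ.arr x)) :=
      tendsto_nhdsWithin_iff.2 ⟨Filter.tendsto_comap, Filter.Eventually.of_forall hmem⟩
    have h3 := h1.comp h2
    have h4 : α.conj ∘ (fun h => ((𝒢.tgt h, 𝒢.src h), φ.arr h)) = fun h => h :=
      funext α.conj_arr
    rw [h4] at h3
    exact h3
  · refine Set.Subset.antisymm (Set.range_subset_iff.2 hmem) ?_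
    rintro ⟨⟨a, b⟩, v⟩ hz
    have ha : φ.obj a = 𝒢'.tgt v := congrArg Prod.fst hz
    have hb : φ.obj b = 𝒢'.src v := congrArg Prod.snd hz
    exact ⟨α.conj ((a, b), v), by
      simp only [α.src_conj ha hb, α.tgt_conj ha hb, α.arr_conj β ha hb]⟩
  · intro h u hu1 hu2
    obtain ⟨D, hD⟩ := hconj h
    have h1 := HasMFDerivWithinAt.comp (s := Set.univ) (g := α.conj)
      (f := fun h => ((𝒢.tgt h, 𝒢.src h), φ.arr h))
      (u := {z | Prod.map φ.obj φ.obj z.1 = (𝒢'.tgt z.2, 𝒢'.src z.2)}) h hD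
      (hdΘ h).hasMFDerivAt_modelDeriv.hasMFDerivWithinAt (fun x _ => hmem x)
    rw [hasMFDerivWithinAt_univ] at h1
    have h2 : α.conj ∘ (fun h => ((𝒢.tgt h, 𝒢.src h), φ.arr h)) = fun h => h :=
      funext α.conj_arr
    rw [h2] at h1
    have h3 : D.comp (modelDeriv I ((J.prod J).prod I')
        (fun h => ((𝒢.tgt h, 𝒢.src h), φ.arr h)) h) = ContinuousLinearMap.id ℝ EG :=
      hasMFDerivAt_unique h1 (hasMFDerivAt_id (I := I) h)
    have h4 : modelDeriv I ((J.prod J).prod I')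
        (fun h => ((𝒢.tgt h, 𝒢.src h), φ.arr h)) h u = 0 := by
      rw [modelDeriv_prodMk (hdts h) (hdφ h)]
      exact Prod.ext hu1 hu2
    have h5 := congrArg (fun A : EG →L[ℝ] EG => A u) h3
    refine Eq.trans h5.symm ?_
    exact (congrArg D h4).trans (map_zero D)
  · intro h a b
    constructor
    · intro hab
      obtain ⟨D, hD⟩ := hconj h
      let p : (M × M) × G' := ((𝒢.tgt h, 𝒢.src h), φ.arr h)
      let ξ : (EM × EM) × EG' := (a, b)
      have hsurj : ∀ w : EM' × EM', ∃ u : (EM × EM) × EG',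
          modelDeriv ((J.prod J).prod I') (J'.prod J')
            (fun z : (M × M) × G' => Prod.map φ.obj φ.obj z.1) p u
          - modelDeriv ((J.prod J).prod I') (J'.prod J')
            (fun z : (M × M) × G' => (𝒢'.tgt z.2, 𝒢'.src z.2)) p u = w := by
        rintro ⟨w₁, w₂⟩
        obtain ⟨b₀, hb₀⟩ := 𝒢'.surjective_modelDeriv_src (φ.arr h) (-w₂)
        obtain ⟨u, v, huv, hu⟩ := (isEssentiallySurjective_of_isoId α β).submersion (φ.arr h)
          (𝒢.src h) (φ.src_arr h) (-(w₁ + modelDeriv I' J' 𝒢'.tgt (φ.arr h) b₀) : EM')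
        let u' : EG' := u
        let v' : EM := v
        have huv' : modelDeriv I' J' 𝒢'.src (φ.arr h) u' = modelDeriv J J' φ.obj (𝒢.src h) v' :=
          huv
        have hu' : modelDeriv I' J' 𝒢'.tgt (φ.arr h) u'
          = -(w₁ + modelDeriv I' J' 𝒢'.tgt (φ.arr h) b₀) := hu
        refine ⟨((0, v'), b₀ + u'), ?_⟩
        rw [modelDeriv_comp_fst (f := Prod.map φ.obj φ.obj) (hdφφ _),
          modelDeriv_comp_snd (f := fun g => (𝒢'.tgt g, 𝒢'.src g)) (hdts' _),
          modelDeriv_prodMk (hdt _) (hds _)]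
        have e : modelDeriv (J.prod J) (J'.prod J') (Prod.map φ.obj φ.obj) p.1
            = ((modelDeriv J J' φ.obj p.1.1).comp (ContinuousLinearMap.fst ℝ EM EM)).prod
              ((modelDeriv J J' φ.obj p.1.2).comp (ContinuousLinearMap.snd ℝ EM EM)) := by
          rw [← modelDeriv_comp_fst (I₂ := J) (N := M) (hdφ₀ _),
            ← modelDeriv_comp_snd (I₁ := J) (P := M) (hdφ₀ _)]
          exact modelDeriv_prodMk (f := fun z : M × M => φ.obj z.1)
            (g := fun z : M × M => φ.obj z.2)
            ((hdφ₀ _).comp p.1 mdifferentiableAt_fst) ((hdφ₀ _).comp p.1 mdifferentiableAt_snd)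
        rw [e]
        simp [p, huv', hu', hb₀]
      have hf : ContMDiff ((J.prod J).prod I') (J'.prod J') ∞
          (fun z : (M × M) × G' => Prod.map φ.obj φ.obj z.1) := hφφ.comp contMDiff_fst
      have hg : ContMDiff ((J.prod J).prod I') (J'.prod J') ∞
          (fun z : (M × M) × G' => (𝒢'.tgt z.2, 𝒢'.src z.2)) := hts'.comp contMDiff_snd
      have hξ : modelDeriv ((J.prod J).prod I') (J'.prod J')
            (fun z : (M × M) × G' => Prod.map φ.obj φ.obj z.1) p ξ
          = modelDeriv ((J.prod J).prod I') (J'.prod J')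
            (fun z : (M × M) × G' => (𝒢'.tgt z.2, 𝒢'.src z.2)) p ξ := by
        rw [modelDeriv_comp_fst (f := Prod.map φ.obj φ.obj) (hdφφ _),
          modelDeriv_comp_snd (f := fun g => (𝒢'.tgt g, 𝒢'.src g)) (hdts' _)]
        exact hab
      have r1 := mfderiv_apply_of_eqOn_equalizer hf.contMDiffAt hg.contMDiffAt (hmem h) hsurj hξ
        hD (χ := fun g => (𝒢.tgt g, 𝒢.src g)) (hdts _) (θ := Prod.fst)
        mdifferentiableAt_fst (fun z hz => Prod.ext
          (α.tgt_conj (congrArg Prod.fst hz) (congrArg Prod.snd hz))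
          (α.src_conj (congrArg Prod.fst hz) (congrArg Prod.snd hz)))
      have r2 := mfderiv_apply_of_eqOn_equalizer hf.contMDiffAt hg.contMDiffAt (hmem h) hsurj hξ
        hD (χ := φ.arr) (hdφ _) (θ := Prod.snd)
        mdifferentiableAt_snd (fun z hz =>
          (α.arr_conj β (congrArg Prod.fst hz) (congrArg Prod.snd hz)))
      rw [modelDeriv_fst] at r1
      rw [modelDeriv_snd] at r2
      rw [α.conj_arr] at r1 r2
      exact ⟨_, r1, r2⟩
    · rintro ⟨u, rfl, rfl⟩
      let u' : EG := u
      have e1 : (fun h => Prod.map φ.obj φ.obj (𝒢.tgt h, 𝒢.src h))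
          = fun h => (𝒢'.tgt (φ.arr h), 𝒢'.src (φ.arr h)) := funext hmem
      have e2 := congrArg (fun f => modelDeriv I (J'.prod J') f h) e1
      rw [modelDeriv_comp (f := fun h => (𝒢.tgt h, 𝒢.src h)) (hdφφ _) (hdts h),
        modelDeriv_comp (g := fun h => (𝒢'.tgt h, 𝒢'.src h)) (hdts' _) (hdφ h)] at e2
      exact congrArg (fun A : EG →L[ℝ] EM' × EM' => A u') e2

/-- A map of Lie groupoids with a smooth quasi-inverse is Morita. -/
theorem isMorita_of_isoId [I'.Boundaryless] [J.Boundaryless] [FiniteDimensional ℝ EG']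
    [FiniteDimensional ℝ EM] [FiniteDimensional ℝ EM']
    (α : IsoId (ψ.comp φ)) (β : IsoId (φ.comp ψ)) : φ.IsMorita :=
  ⟨isFullyFaithful_of_isoId α β, isEssentiallySurjective_of_isoId α β⟩

end Equivalence
end LieGroupoid.Map
end LieGroupoids

/-! ### Smooth families of linear maps -/

section Families

variable {EX : Type*} [NormedAddCommGroup EX] [NormedSpace ℝ EX]
  {HX : Type*} [TopologicalSpace HX] {IX : ModelWithCorners ℝ EX HX}
  {X : Type*} [TopologicalSpace X] [ChartedSpace HX X]
  {F : Type*} [NormedAddCommGroup F] [NormedSpace ℝ F]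
  {W : Type*} [NormedAddCommGroup W] [NormedSpace ℝ W]

/-- A smooth family of endomorphisms equal to the identity at `x₀` is invertible near `x₀`, with
smooth inverse. -/
theorem exists_smooth_inverse [FiniteDimensional ℝ F] {A : X → F →L[ℝ] F} {x₀ : X}
    (hA : ∀ᶠ x in 𝓝 x₀, ContMDiffAt IX 𝓘(ℝ, F →L[ℝ] F) ∞ A x)
    (h₀ : A x₀ = ContinuousLinearMap.id ℝ F) :
    ∀ᶠ x in 𝓝 x₀, (A x).IsInvertible ∧
      ContMDiffAt IX 𝓘(ℝ, F →L[ℝ] F) ∞ (fun y => (A y).inverse) x := by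
  have := FiniteDimensional.complete ℝ F
  have h1 : ∀ᶠ x in 𝓝 x₀, (A x).IsInvertible := by
    have h2 : Set.range ((↑) : (F ≃L[ℝ] F) → F →L[ℝ] F) ∈ 𝓝 (A x₀) := by
      rw [h₀]
      exact ContinuousLinearEquiv.nhds (ContinuousLinearEquiv.refl ℝ F)
    exact hA.self_of_nhds.continuousAt.eventually h2
  filter_upwards [h1, hA] with x hx hAx
  exact ⟨hx, ContDiffAt.contMDiffAt hx.contDiffAt_map_inverse |>.comp x hAx⟩

/-- A smooth family of linear maps that is injective at `x₀` has a smooth left inverse near `x₀`. -/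
theorem exists_smooth_leftInverse [FiniteDimensional ℝ F] [FiniteDimensional ℝ W]
    {A : X → F →L[ℝ] W} {x₀ : X}
    (hA : ∀ᶠ x in 𝓝 x₀, ContMDiffAt IX 𝓘(ℝ, F →L[ℝ] W) ∞ A x) (h₀ : Function.Injective (A x₀)) :
    ∃ K : X → W →L[ℝ] F, (∀ᶠ x in 𝓝 x₀, ContMDiffAt IX 𝓘(ℝ, W →L[ℝ] F) ∞ K x) ∧
      ∀ᶠ x in 𝓝 x₀, ∀ v, K x (A x v) = v := by
  obtain ⟨k, hk⟩ := (A x₀ : F →ₗ[ℝ] W).exists_leftInverse_of_injective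
    (LinearMap.ker_eq_bot.2 h₀)
  let K₀ : W →L[ℝ] F := k.toContinuousLinearMap
  have hK₀ : K₀.comp (A x₀) = ContinuousLinearMap.id ℝ F := by
    ext v
    exact LinearMap.congr_fun hk v
  have hKA : ∀ᶠ x in 𝓝 x₀, ContMDiffAt IX 𝓘(ℝ, F →L[ℝ] F) ∞ (fun x => K₀.comp (A x)) x := by
    filter_upwards [hA] with x hx
    exact contMDiffAt_const.clm_comp hx
  have hinv := exists_smooth_inverse hKA hK₀
  refine ⟨fun x => (K₀.comp (A x)).inverse.comp K₀, ?_, ?_⟩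
  · filter_upwards [hinv] with x hx
    exact hx.2.clm_comp contMDiffAt_const
  · filter_upwards [hinv] with x hx v
    exact hx.1.inverse_apply_self v

/-- A smooth family of linear maps that is surjective at `x₀` has a smooth right inverse near
`x₀`. -/
theorem exists_smooth_rightInverse [FiniteDimensional ℝ W]
    {A : X → F →L[ℝ] W} {x₀ : X}
    (hA : ∀ᶠ x in 𝓝 x₀, ContMDiffAt IX 𝓘(ℝ, F →L[ℝ] W) ∞ A x) (h₀ : Function.Surjective (A x₀)) :
    ∃ K : X → W →L[ℝ] F, (∀ᶠ x in 𝓝 x₀, ContMDiffAt IX 𝓘(ℝ, W →L[ℝ] F) ∞ K x) ∧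
      ∀ᶠ x in 𝓝 x₀, ∀ w, A x (K x w) = w := by
  obtain ⟨k, hk⟩ := (A x₀ : F →ₗ[ℝ] W).exists_rightInverse_of_surjective
    (LinearMap.range_eq_top.2 h₀)
  let K₀ : W →L[ℝ] F := k.toContinuousLinearMap
  have hK₀ : (A x₀).comp K₀ = ContinuousLinearMap.id ℝ W := by
    ext v
    exact LinearMap.congr_fun hk v
  have hKA : ∀ᶠ x in 𝓝 x₀, ContMDiffAt IX 𝓘(ℝ, W →L[ℝ] W) ∞ (fun x => (A x).comp K₀) x := by
    filter_upwards [hA] with x hx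
    exact hx.clm_comp contMDiffAt_const
  have hinv := exists_smooth_inverse hKA hK₀
  refine ⟨fun x => K₀.comp ((A x).comp K₀).inverse, ?_, ?_⟩
  · filter_upwards [hinv] with x hx
    exact contMDiffAt_const.clm_comp hx.2
  · filter_upwards [hinv] with x hx w
    exact hx.1.self_apply_inverse w

end Families

/-! ### Fiberwise linear maps -/

section FiberwiseLinear

variable {B F C F' : Type*} {V : B → Type*} [∀ x, AddCommGroup (V x)] [∀ x, Module ℝ (V x)]
  {U : C → Type*} [∀ x, AddCommGroup (U x)] [∀ x, Module ℝ (U x)]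
  {W : Type*} [AddCommGroup W] [Module ℝ W]

theorem IsFiberwiseLinear.proj_eq {f : B → C} {Φ : TotalSpace F V → TotalSpace F' U}
    (hΦ : IsFiberwiseLinear f Φ) (p : TotalSpace F V) : (Φ p).proj = f p.proj := by
  obtain ⟨L, hL⟩ := hΦ p.proj
  rw [← TotalSpace.eta p, hL]

theorem IsFiberwiseLinear.apply_zero {f : B → C} {Φ : TotalSpace F V → TotalSpace F' U}
    (hΦ : IsFiberwiseLinear f Φ) (x : B) : Φ ⟨x, 0⟩ = ⟨f x, 0⟩ := by
  obtain ⟨L, hL⟩ := hΦ x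
  rw [hL, map_zero]

/-- A lift through functions that are jointly injective and linear on the fibers is linear. -/
theorem isFiberwiseLinear_of_injective_on_fiber {f : C → B}
    {h : TotalSpace F' U → TotalSpace F V} (hproj : ∀ p, (h p).proj = f p.proj)
    (hq : ∀ x, ∃ q : TotalSpace F V → W, IsLinearMap ℝ (fun v : V (f x) => q ⟨f x, v⟩) ∧
      Function.Injective (fun v : V (f x) => q ⟨f x, v⟩) ∧
      IsLinearMap ℝ (fun u : U x => q (h ⟨x, u⟩))) :
    IsFiberwiseLinear f h := by
  intro x
  obtain ⟨q, hlin, hinj, hqh⟩ := hq x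
  have hk : ∀ u : U x, ∃ v : V (f x), h ⟨x, u⟩ = ⟨f x, v⟩ := by
    intro u
    have h1 := hproj ⟨x, u⟩
    generalize h ⟨x, u⟩ = p at h1
    obtain ⟨y, v⟩ := p
    cases h1
    exact ⟨v, rfl⟩
  choose k hk using hk
  refine ⟨⟨⟨k, fun u u' => hinj ?_⟩, fun c u => hinj ?_⟩, hk⟩
  · have := hqh.map_add u u'
    simp only [hk] at this
    simp only [this, hlin.map_add]
  · have := hqh.map_smul c u
    simp only [hk] at this
    simp only [this, RingHom.id_apply, hlin.map_smul]

end FiberwiseLinear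

/-! ### Fiber coordinates -/

section FiberCoord

variable {B : Type*} [TopologicalSpace B] {F : Type*} [NormedAddCommGroup F]
  {V : B → Type*} [∀ x, TopologicalSpace (V x)] [TopologicalSpace (TotalSpace F V)]
  [FiberBundle F V]

/-- The fiber coordinate of a point of a vector bundle in the preferred trivialization at `x₀`;
meaningful over the base set of that trivialization. -/
def fiberCoord (x₀ : B) (p : TotalSpace F V) : F := (trivializationAt F V x₀ p).2

theorem eventually_mem_baseSet (x₀ : B) :
    ∀ᶠ x in 𝓝 x₀, x ∈ (trivializationAt F V x₀).baseSet :=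
  (trivializationAt F V x₀).open_baseSet.mem_nhds (mem_baseSet_trivializationAt F V x₀)

theorem eq_of_fiberCoord_eq {x₀ : B} {p q : TotalSpace F V}
    (hp : p.proj ∈ (trivializationAt F V x₀).baseSet) (hpq : p.proj = q.proj)
    (h : fiberCoord x₀ p = fiberCoord x₀ q) : p = q := by
  have hq : q.proj ∈ (trivializationAt F V x₀).baseSet := hpq ▸ hp
  refine (trivializationAt F V x₀).injOn ((trivializationAt F V x₀).mem_source.2 hp)
    ((trivializationAt F V x₀).mem_source.2 hq) (Prod.ext ?_ h)
  exact (Trivialization.coe_fst' _ hp).trans (hpq.trans (Trivialization.coe_fst' _ hq).symm)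

theorem fiberCoord_symm [∀ x, AddCommGroup (V x)]
    {x₀ x : B} (hx : x ∈ (trivializationAt F V x₀).baseSet) (w : F) :
    fiberCoord x₀ (⟨x, (trivializationAt F V x₀).symm x w⟩ : TotalSpace F V) = w := by
  rw [fiberCoord, Trivialization.apply_mk_symm _ hx]

theorem symm_fiberCoord [∀ x, AddCommGroup (V x)]
    {x₀ x : B} (hx : x ∈ (trivializationAt F V x₀).baseSet) (v : V x) :
    (trivializationAt F V x₀).symm x (fiberCoord x₀ (⟨x, v⟩ : TotalSpace F V)) = v :=
  Trivialization.symm_apply_apply_mk _ hx v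

end FiberCoord

section FiberCoord

variable {EB : Type*} [NormedAddCommGroup EB] [NormedSpace ℝ EB]
  {HB : Type*} [TopologicalSpace HB] {IB : ModelWithCorners ℝ EB HB}
  {B : Type*} [TopologicalSpace B] [ChartedSpace HB B]
  {F : Type*} [NormedAddCommGroup F] [NormedSpace ℝ F]
  {V : B → Type*} [∀ x, AddCommGroup (V x)] [∀ x, Module ℝ (V x)]
  [∀ x, TopologicalSpace (V x)] [TopologicalSpace (TotalSpace F V)]
  [FiberBundle F V]
  {EC : Type*} [NormedAddCommGroup EC] [NormedSpace ℝ EC]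
  {HC : Type*} [TopologicalSpace HC] {IC : ModelWithCorners ℝ EC HC}
  {C : Type*} [TopologicalSpace C] [ChartedSpace HC C]
  {F' : Type*} [NormedAddCommGroup F'] [NormedSpace ℝ F']
  {U : C → Type*} [∀ x, AddCommGroup (U x)] [∀ x, Module ℝ (U x)]
  [∀ x, TopologicalSpace (U x)] [TopologicalSpace (TotalSpace F' U)]
  [FiberBundle F' U]
  {EX : Type*} [NormedAddCommGroup EX] [NormedSpace ℝ EX]
  {HX : Type*} [TopologicalSpace HX] {IX : ModelWithCorners ℝ EX HX}
  {X : Type*} [TopologicalSpace X] [ChartedSpace HX X]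
  {W : Type*} [NormedAddCommGroup W] [NormedSpace ℝ W]

theorem isLinearMap_fiberCoord [VectorBundle ℝ F V] {x₀ x : B}
    (hx : x ∈ (trivializationAt F V x₀).baseSet) :
    IsLinearMap ℝ (fun v : V x => fiberCoord x₀ (⟨x, v⟩ : TotalSpace F V)) :=
  (trivializationAt F V x₀).linear ℝ hx

theorem IsFiberwiseLinear.isLinearMap_fiberCoord {B F C F' : Type*}
    {V : B → Type*} [∀ x, AddCommGroup (V x)] [∀ x, Module ℝ (V x)] [TopologicalSpace C]
    [NormedAddCommGroup F'] [NormedSpace ℝ F']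
    {U : C → Type*} [∀ x, AddCommGroup (U x)] [∀ x, Module ℝ (U x)] [∀ x, TopologicalSpace (U x)]
    [TopologicalSpace (TotalSpace F' U)] [FiberBundle F' U] [VectorBundle ℝ F' U] {f : B → C}
    {Φ : TotalSpace F V → TotalSpace F' U} (hΦ : IsFiberwiseLinear f Φ) {x : B} {y₀ : C}
    (hx : f x ∈ (trivializationAt F' U y₀).baseSet) :
    IsLinearMap ℝ (fun v : V x => fiberCoord y₀ (Φ ⟨x, v⟩)) := by
  obtain ⟨L, hL⟩ := hΦ x
  have h := _root_.isLinearMap_fiberCoord (F := F') (V := U) hx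
  refine ⟨fun v w => ?_, fun c v => ?_⟩
  · simp only [hL, map_add, h.map_add]
  · simp only [hL, map_smul, h.map_smul]

theorem contMDiffAt_fiberCoord [VectorBundle ℝ F V] [ContMDiffVectorBundle ∞ F V IB]
    {x₀ : B} {p : TotalSpace F V}
    (hp : p.proj ∈ (trivializationAt F V x₀).baseSet) :
    ContMDiffAt (IB.prod 𝓘(ℝ, F)) 𝓘(ℝ, F) ∞ (fiberCoord (F := F) (V := V) x₀) p :=
  (((trivializationAt F V x₀).contMDiffAt_iff (f := fun p => p)
    ((trivializationAt F V x₀).mem_source.2 hp)).1 contMDiffAt_id).2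

theorem contMDiffAt_totalSpace_iff_fiberCoord [VectorBundle ℝ F V] [ContMDiffVectorBundle ∞ F V IB]
    {x₀ : B} {h : X → TotalSpace F V} {y : X}
    (hy : (h y).proj ∈ (trivializationAt F V x₀).baseSet) :
    ContMDiffAt IX (IB.prod 𝓘(ℝ, F)) ∞ h y ↔ ContMDiffAt IX IB ∞ (fun x => (h x).proj) y ∧
      ContMDiffAt IX 𝓘(ℝ, F) ∞ (fun x => fiberCoord x₀ (h x)) y :=
  (trivializationAt F V x₀).contMDiffAt_iff ((trivializationAt F V x₀).mem_source.2 hy)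

theorem contMDiffAt_mk_symm [VectorBundle ℝ F V] [ContMDiffVectorBundle ∞ F V IB]
    {x₀ : B} {f : X → B} {w : X → F} {y : X}
    (hy : f y ∈ (trivializationAt F V x₀).baseSet) (hf : ContMDiffAt IX IB ∞ f y)
    (hw : ContMDiffAt IX 𝓘(ℝ, F) ∞ w y) :
    ContMDiffAt IX (IB.prod 𝓘(ℝ, F)) ∞
      (fun x => (⟨f x, (trivializationAt F V x₀).symm (f x) (w x)⟩ : TotalSpace F V)) y := by
  refine (contMDiffAt_totalSpace_iff_fiberCoord (x₀ := x₀) hy).2 ⟨hf, ?_⟩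
  refine hw.congr_of_eventuallyEq ?_
  filter_upwards [hf.continuousAt.eventually
    ((trivializationAt F V x₀).open_baseSet.mem_nhds hy)] with x hx
  exact fiberCoord_symm hx _

/-- A function on a vector bundle that is smooth and linear on the fibers near `x₀` is given, in
the trivialization at `x₀`, by a smooth family of linear maps. -/
theorem exists_smooth_matrix [VectorBundle ℝ F V] [ContMDiffVectorBundle ∞ F V IB]
    [FiniteDimensional ℝ F] {q : TotalSpace F V → W} {x₀ : B}
    (hlin : ∀ᶠ x in 𝓝 x₀, IsLinearMap ℝ (fun v : V x => q ⟨x, v⟩))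
    (hq : ∀ᶠ x in 𝓝 x₀, ∀ v : V x, ContMDiffAt (IB.prod 𝓘(ℝ, F)) 𝓘(ℝ, W) ∞ q ⟨x, v⟩) :
    ∃ A : B → F →L[ℝ] W, (∀ᶠ x in 𝓝 x₀, ContMDiffAt IB 𝓘(ℝ, F →L[ℝ] W) ∞ A x) ∧
      ∀ᶠ x in 𝓝 x₀, ∀ v : V x, q ⟨x, v⟩ = A x (fiberCoord x₀ (⟨x, v⟩ : TotalSpace F V)) := by
  let b := Module.finBasis ℝ F
  let e := trivializationAt F V x₀
  let A : B → F →L[ℝ] W := fun x => ∑ i, (b.coord i).toContinuousLinearMap.smulRight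
    (q ⟨x, e.symm x (b i)⟩)
  refine ⟨A, ?_, ?_⟩
  · filter_upwards [hq, eventually_mem_baseSet (F := F) (V := V) x₀] with x hx hxe
    refine ContMDiffAt.sum fun i _ => ?_
    have h1 : ContMDiffAt IB 𝓘(ℝ, W) ∞ (fun y => q ⟨y, e.symm y (b i)⟩) x :=
      ContMDiffAt.comp (g := q) (f := fun y => (⟨y, e.symm y (b i)⟩ : TotalSpace F V)) x (hx _)
        (contMDiffAt_mk_symm hxe contMDiffAt_id contMDiffAt_const)
    have h2 : ContDiff ℝ ∞ (fun w : W => (b.coord i).toContinuousLinearMap.smulRight w) :=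
      contDiff_const.smulRight contDiff_id
    exact h2.contMDiff.contMDiffAt.comp x h1
  · filter_upwards [hlin, eventually_mem_baseSet (F := F) (V := V) x₀] with x hx hxe v
    let L := hx.mk'
    have h1 : ∀ w : F, q ⟨x, e.symm x w⟩ = L (e.symmₗ ℝ x w) := fun w => by
      rw [e.symmₗ_apply hxe]; rfl
    simp only [A, sum_apply, ContinuousLinearMap.smulRight_apply, h1,
      ← map_smul, ← map_sum]
    have h2 : ∑ i, (b.coord i).toContinuousLinearMap (fiberCoord x₀ ⟨x, v⟩) • b i
        = fiberCoord x₀ ⟨x, v⟩ := b.sum_repr _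
    rw [h2, e.symmₗ_apply hxe, symm_fiberCoord hxe]
    rfl

/-- A lift through functions that are jointly injective on the fibers is smooth: near a point, the
fiber coordinate of the lift is recovered by a smooth left inverse. -/
theorem contMDiffAt_of_injective_on_fiber [VectorBundle ℝ F V] [ContMDiffVectorBundle ∞ F V IB]
    [FiniteDimensional ℝ F] [FiniteDimensional ℝ W] {q : TotalSpace F V → W}
    {h : X → TotalSpace F V} {y : X}
    (hlin : ∀ᶠ x in 𝓝 (h y).proj, IsLinearMap ℝ (fun v : V x => q ⟨x, v⟩))
    (hq : ∀ᶠ x in 𝓝 (h y).proj, ∀ v : V x, ContMDiffAt (IB.prod 𝓘(ℝ, F)) 𝓘(ℝ, W) ∞ q ⟨x, v⟩)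
    (hinj : Function.Injective (fun v : V (h y).proj => q ⟨(h y).proj, v⟩))
    (hproj : ContMDiffAt IX IB ∞ (fun x => (h x).proj) y)
    (hqh : ContMDiffAt IX 𝓘(ℝ, W) ∞ (fun x => q (h x)) y) :
    ContMDiffAt IX (IB.prod 𝓘(ℝ, F)) ∞ h y := by
  obtain ⟨A, hA, hqA⟩ := exists_smooth_matrix hlin hq
  have hb := mem_baseSet_trivializationAt F V (h y).proj
  have hA₀ : Function.Injective (A (h y).proj) := by
    intro v w hvw
    have h1 := hqA.self_of_nhds ((trivializationAt F V (h y).proj).symm _ v)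
    have h2 := hqA.self_of_nhds ((trivializationAt F V (h y).proj).symm _ w)
    rw [fiberCoord_symm hb] at h1 h2
    have h3 := hinj (h1.trans (hvw.trans h2.symm))
    rw [← fiberCoord_symm (V := V) hb v, h3, fiberCoord_symm hb]
  obtain ⟨K, hK, hKA⟩ := exists_smooth_leftInverse hA hA₀
  refine (contMDiffAt_totalSpace_iff_fiberCoord hb).2 ⟨hproj, ?_⟩
  have h1 : ContMDiffAt IX 𝓘(ℝ, F) ∞ (fun x => K (h x).proj (q (h x))) y :=
    ContMDiffAt.clm_apply (ContMDiffAt.comp y (g := K) hK.self_of_nhds hproj) hqh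
  refine h1.congr_of_eventuallyEq ?_
  filter_upwards [hproj.continuousAt.eventually hqA, hproj.continuousAt.eventually hKA]
    with x h2 h3
  have h4 := h2 (h x).2
  rw [TotalSpace.eta] at h4
  rw [h4, h3]

/-- Fiberwise linear maps are glued by a partition of unity. -/
theorem contMDiff_partitionOfUnity_sum [VectorBundle ℝ F V] [ContMDiffVectorBundle ∞ F V IB]
    [FiniteDimensional ℝ EC] {ι : Type*}
    [VectorBundle ℝ F' U] [ContMDiffVectorBundle ∞ F' U IC]
    (ρ : SmoothPartitionOfUnity ι IC C Set.univ) {O : ι → Set C} (hρ : ρ.IsSubordinate O)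
    {f : C → B} (hf : ContMDiff IC IB ∞ f) (σ : ∀ (_ : ι) (x : C), U x →ₗ[ℝ] V (f x))
    (hσ : ∀ i, ∀ x ∈ O i, ∀ u : U x, ContMDiffAt (IC.prod 𝓘(ℝ, F')) (IB.prod 𝓘(ℝ, F)) ∞
      (fun p : TotalSpace F' U => (⟨f p.1, σ i p.1 p.2⟩ : TotalSpace F V)) ⟨x, u⟩) :
    ContMDiff (IC.prod 𝓘(ℝ, F')) (IB.prod 𝓘(ℝ, F)) ∞
      (fun p : TotalSpace F' U =>
        (⟨f p.1, ∑ i ∈ ρ.finsupport p.1, ρ i p.1 • σ i p.1 p.2⟩ : TotalSpace F V)) := by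
  rintro ⟨x, u⟩
  have hb := mem_baseSet_trivializationAt F V (f x)
  have hpr : ContMDiff (IC.prod 𝓘(ℝ, F')) IC ∞ (TotalSpace.proj : TotalSpace F' U → C) :=
    contMDiff_proj U
  refine (contMDiffAt_totalSpace_iff_fiberCoord (x₀ := f x) hb).2
    ⟨(hf.comp hpr).contMDiffAt, ?_⟩
  have h1 : ContMDiffAt (IC.prod 𝓘(ℝ, F')) 𝓘(ℝ, F) ∞
      (fun p : TotalSpace F' U => ∑ i ∈ ρ.fintsupport x,
        ρ i p.1 • fiberCoord (f x) (⟨f p.1, σ i p.1 p.2⟩ : TotalSpace F V)) ⟨x, u⟩ := by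
    refine ContMDiffAt.sum fun i hi => ?_
    refine ContMDiffAt.smul (((ρ i).contMDiff.comp hpr).contMDiffAt) ?_
    refine ((contMDiffAt_totalSpace_iff_fiberCoord (x₀ := f x) hb).1 (hσ i x ?_ u)).2
    exact hρ i ((ρ.mem_fintsupport_iff x i).1 hi)
  refine h1.congr_of_eventuallyEq ?_
  have hc : ContinuousAt (TotalSpace.proj : TotalSpace F' U → C) ⟨x, u⟩ :=
    hpr.continuous.continuousAt
  filter_upwards [hc.eventually (ρ.eventually_finsupport_subset x),
    (hf.continuous.continuousAt.comp hc).eventually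
      (eventually_mem_baseSet (F := F) (V := V) (f x))] with p hp hpb
  have hl := isLinearMap_fiberCoord (F := F) (V := V) hpb
  refine (map_sum hl.mk' _ _).trans ?_
  refine Eq.trans (Finset.sum_congr rfl fun i _ => map_smul hl.mk' _ _) ?_
  refine Finset.sum_subset hp fun i _ hi => ?_
  have : ρ i p.1 = 0 := by simpa using hi
  rw [this, zero_smul]

end FiberCoord

/-! ### The vertical part of the differential along the zero section -/

section Vertical

variable {EB : Type*} [NormedAddCommGroup EB] [NormedSpace ℝ EB]
  {HB : Type*} [TopologicalSpace HB] {IB : ModelWithCorners ℝ EB HB}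
  {B : Type*} [TopologicalSpace B] [ChartedSpace HB B]
  {F : Type*} [NormedAddCommGroup F] [NormedSpace ℝ F]
  {V : B → Type*}
  [∀ x, TopologicalSpace (V x)] [TopologicalSpace (TotalSpace F V)]
  [FiberBundle F V]
  {EC : Type*} [NormedAddCommGroup EC] [NormedSpace ℝ EC]
  {HC : Type*} [TopologicalSpace HC] {IC : ModelWithCorners ℝ EC HC}
  {C : Type*} [TopologicalSpace C] [ChartedSpace HC C]
  {F' : Type*} [NormedAddCommGroup F'] [NormedSpace ℝ F']
  {U : C → Type*} [∀ x, AddCommGroup (U x)] [∀ x, Module ℝ (U x)]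
  [∀ x, TopologicalSpace (U x)] [TopologicalSpace (TotalSpace F' U)]
  [FiberBundle F' U] [VectorBundle ℝ F' U] [ContMDiffVectorBundle ∞ F' U IC]

/-- The charts of the total space are the preferred trivializations, so the fiber coordinate has
differential the second projection. -/
theorem hasMFDerivAt_fiberCoord (p : TotalSpace F V) :
    HasMFDerivAt (IB.prod 𝓘(ℝ, F)) 𝓘(ℝ, F) (fiberCoord (F := F) (V := V) p.proj) p
      (ContinuousLinearMap.snd ℝ EB F) := by
  have h1 : HasMFDerivAt (IB.prod 𝓘(ℝ, F)) (IB.prod 𝓘(ℝ, F)) (trivializationAt F V p.proj) p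
      (ContinuousLinearMap.id ℝ (EB × F)) := by
    refine ⟨((trivializationAt F V p.proj).continuousOn.continuousAt
      ((trivializationAt F V p.proj).open_source.mem_nhds
        (FiberBundle.mem_trivializationAt_proj_source))), ?_⟩
    have h2 : ∀ᶠ y in 𝓝[Set.range (IB.prod 𝓘(ℝ, F))] (extChartAt (IB.prod 𝓘(ℝ, F)) p p),
        writtenInExtChartAt (IB.prod 𝓘(ℝ, F)) (IB.prod 𝓘(ℝ, F)) p (trivializationAt F V p.proj) y
          = y := by
      filter_upwards [extChartAt_target_mem_nhdsWithin p] with y hy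
      exact FiberBundle.writtenInExtChartAt_trivializationAt hy
    exact HasFDerivWithinAt.congr_of_eventuallyEq (hasFDerivWithinAt_id _ _) h2
      (h2.self_of_nhdsWithin (Set.mem_range_self _))
  exact (hasMFDerivAt_snd (I := IB) (I' := 𝓘(ℝ, F)) _).comp p h1

/-- In trivializations, a smooth fiberwise linear map is a smooth family of linear maps. Its value
at `x₀` is the vertical part of the differential at the zero vector over `x₀`. -/
theorem IsFiberwiseLinear.exists_smooth_matrix [∀ x, AddCommGroup (V x)]
    [∀ x, Module ℝ (V x)] [VectorBundle ℝ F V]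
    [ContMDiffVectorBundle ∞ F V IB] [FiniteDimensional ℝ F] {f : B → C}
    {Φ : TotalSpace F V → TotalSpace F' U} (hlin : IsFiberwiseLinear f Φ)
    (hΦ : ContMDiff (IB.prod 𝓘(ℝ, F)) (IC.prod 𝓘(ℝ, F')) ∞ Φ) (hf : Continuous f)
    {x₀ : B} {y₀ : C} (hy₀ : f x₀ = y₀) :
    ∃ A : B → F →L[ℝ] F', (∀ᶠ x in 𝓝 x₀, ContMDiffAt IB 𝓘(ℝ, F →L[ℝ] F') ∞ A x) ∧
      (∀ᶠ x in 𝓝 x₀, ∀ v : V x,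
        fiberCoord y₀ (Φ ⟨x, v⟩) = A x (fiberCoord x₀ (⟨x, v⟩ : TotalSpace F V))) ∧
      ∀ u : EB × F, (modelDeriv (IB.prod 𝓘(ℝ, F)) (IC.prod 𝓘(ℝ, F')) Φ ⟨x₀, 0⟩ u).2
        = A x₀ u.2 := by
  subst hy₀
  have hbase : ∀ᶠ x in 𝓝 x₀, f x ∈ (trivializationAt F' U (f x₀)).baseSet :=
    hf.continuousAt.eventually (eventually_mem_baseSet (F := F') (V := U) (f x₀))
  obtain ⟨A, hA, hqA⟩ := _root_.exists_smooth_matrix (IB := IB) (x₀ := x₀)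
    (q := fun p : TotalSpace F V => fiberCoord (f x₀) (Φ p))
    (hbase.mono fun x hx => hlin.isLinearMap_fiberCoord hx)
    (hbase.mono fun x hx v => ContMDiffAt.comp (g := fiberCoord (f x₀)) (f := Φ)
      (⟨x, v⟩ : TotalSpace F V)
      (contMDiffAt_fiberCoord (IB := IC) (by rw [hlin.proj_eq]; exact hx)) hΦ.contMDiffAt)
  refine ⟨A, hA, hqA, fun u => ?_⟩
  let z : TotalSpace F V := ⟨x₀, 0⟩
  have hpr : ContMDiff (IB.prod 𝓘(ℝ, F)) IB ∞ (TotalSpace.proj : TotalSpace F V → B) :=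
    contMDiff_proj V
  have hd : MDifferentiableAt (IB.prod 𝓘(ℝ, F)) 𝓘(ℝ, F →L[ℝ] F')
      (fun p : TotalSpace F V => A p.proj) z :=
    (ContMDiffAt.comp z (g := A) hA.self_of_nhds hpr.contMDiffAt).mdifferentiableAt (by simp)
  have h0 : fiberCoord x₀ z = 0 :=
    (_root_.isLinearMap_fiberCoord (mem_baseSet_trivializationAt F V x₀)).map_zero
  have hc := hasMFDerivAt_fiberCoord (IB := IB) z
  let k : TotalSpace F V → (F →L[ℝ] F') × F := fun p => (A p.proj, fiberCoord x₀ p)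
  have hk : MDifferentiableAt (IB.prod 𝓘(ℝ, F)) 𝓘(ℝ, (F →L[ℝ] F') × F) k z :=
    hd.prodMk_space hc.mdifferentiableAt
  have hk₂ : (ContinuousLinearMap.snd ℝ (F →L[ℝ] F') F).comp
      (modelDeriv (IB.prod 𝓘(ℝ, F)) 𝓘(ℝ, (F →L[ℝ] F') × F) k z)
      = ContinuousLinearMap.snd ℝ EB F :=
    hasMFDerivAt_unique (HasMFDerivAt.comp z
      (ContinuousLinearMap.snd ℝ (F →L[ℝ] F') F).hasFDerivAt.hasMFDerivAt
      hk.hasMFDerivAt_modelDeriv) hc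
  have h2 := HasMFDerivAt.comp z (g := fun q : (F →L[ℝ] F') × F => q.1 q.2)
    (isBoundedBilinearMap_apply.hasFDerivAt (k z)).hasMFDerivAt hk.hasMFDerivAt_modelDeriv
  have hΦz : (Φ z).proj = f x₀ := hlin.proj_eq z
  have h3 := hasMFDerivAt_fiberCoord (IB := IC) (Φ z)
  rw [hΦz] at h3
  have h4 := HasMFDerivAt.comp z h3
    (hΦ.contMDiffAt.mdifferentiableAt (by simp)).hasMFDerivAt_modelDeriv
  have h5 : (fiberCoord (f x₀) ∘ Φ : TotalSpace F V → F') =ᶠ[𝓝 z]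
      (fun q : (F →L[ℝ] F') × F => q.1 q.2) ∘ k := by
    have hz : ContinuousAt (TotalSpace.proj : TotalSpace F V → B) z :=
      hpr.continuous.continuousAt
    filter_upwards [hz.eventually hqA] with p hp
    exact hp p.2
  have h6 : (ContinuousLinearMap.snd ℝ EC F').comp
      (modelDeriv (IB.prod 𝓘(ℝ, F)) (IC.prod 𝓘(ℝ, F')) Φ z) =
      (isBoundedBilinearMap_apply.deriv (k z)).comp
      (modelDeriv (IB.prod 𝓘(ℝ, F)) 𝓘(ℝ, (F →L[ℝ] F') × F) k z) :=
    hasMFDerivAt_unique h4 (h2.congr_of_eventuallyEq h5)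
  have h7 := congrArg (fun D : EB × F →L[ℝ] F' => D u) h6
  have h8 := congrArg (fun D : EB × F →L[ℝ] F => D u) hk₂
  simp only [ContinuousLinearMap.comp_apply, ContinuousLinearMap.coe_snd'] at h8
  simpa [h0, h8, k] using h7

end Vertical

/-! ### VB-groupoids: Morita maps are equivalences -/

theorem LieGroupoid.inv_one {EG : Type*} [NormedAddCommGroup EG] [NormedSpace ℝ EG]
    {HG : Type*} [TopologicalSpace HG]
    {EM : Type*} [NormedAddCommGroup EM] [NormedSpace ℝ EM]
    {HM : Type*} [TopologicalSpace HM]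
    {I : ModelWithCorners ℝ EG HG} {J : ModelWithCorners ℝ EM HM}
    {G : Type*} [TopologicalSpace G] [ChartedSpace HG G]
    {M : Type*} [TopologicalSpace M] [ChartedSpace HM M]
    (𝒢 : LieGroupoid I J G M) (x : M) : 𝒢.inv (𝒢.one x) = 𝒢.one x := by
  have h1 := 𝒢.mul_one (𝒢.inv (𝒢.one x))
  have h2 := 𝒢.inv_mul (𝒢.one x)
  rw [𝒢.src_inv, 𝒢.tgt_one] at h1
  rw [𝒢.src_one] at h2
  exact h1.symm.trans h2

section VBGroupoids

variable {EG : Type*} [NormedAddCommGroup EG] [NormedSpace ℝ EG]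
  {HG : Type*} [TopologicalSpace HG] {I : ModelWithCorners ℝ EG HG}
  {EM : Type*} [NormedAddCommGroup EM] [NormedSpace ℝ EM]
  {HM : Type*} [TopologicalSpace HM] {J : ModelWithCorners ℝ EM HM}
  {G : Type*} [TopologicalSpace G] [ChartedSpace HG G]
  {M : Type*} [TopologicalSpace M] [ChartedSpace HM M]
  {𝒢 : LieGroupoid I J G M}
  {FΓ : Type*} [NormedAddCommGroup FΓ] [NormedSpace ℝ FΓ]
  {Γ : G → Type*} [∀ g, AddCommGroup (Γ g)] [∀ g, Module ℝ (Γ g)]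
  [∀ g, TopologicalSpace (Γ g)] [TopologicalSpace (TotalSpace FΓ Γ)]
  [FiberBundle FΓ Γ] [VectorBundle ℝ FΓ Γ] [ContMDiffVectorBundle ∞ FΓ Γ I]
  {FE : Type*} [NormedAddCommGroup FE] [NormedSpace ℝ FE]
  {E : M → Type*} [∀ x, AddCommGroup (E x)] [∀ x, Module ℝ (E x)]
  [∀ x, TopologicalSpace (E x)] [TopologicalSpace (TotalSpace FE E)]
  [FiberBundle FE E] [VectorBundle ℝ FE E] [ContMDiffVectorBundle ∞ FE E J]
  {FΓ' : Type*} [NormedAddCommGroup FΓ'] [NormedSpace ℝ FΓ']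
  {Γ' : G → Type*} [∀ g, AddCommGroup (Γ' g)] [∀ g, Module ℝ (Γ' g)]
  [∀ g, TopologicalSpace (Γ' g)] [TopologicalSpace (TotalSpace FΓ' Γ')]
  [FiberBundle FΓ' Γ'] [VectorBundle ℝ FΓ' Γ'] [ContMDiffVectorBundle ∞ FΓ' Γ' I]
  {FE' : Type*} [NormedAddCommGroup FE'] [NormedSpace ℝ FE']
  {E' : M → Type*} [∀ x, AddCommGroup (E' x)] [∀ x, Module ℝ (E' x)]
  [∀ x, TopologicalSpace (E' x)] [TopologicalSpace (TotalSpace FE' E')]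
  [FiberBundle FE' E'] [VectorBundle ℝ FE' E'] [ContMDiffVectorBundle ∞ FE' E' J]
  {𝒱 : VBGroupoid 𝒢 FΓ Γ FE E} {𝒱' : VBGroupoid 𝒢 FΓ' Γ' FE' E'}

theorem VBGroupoid.isFiberwiseLinear_mul {B FU : Type*} {U : B → Type*} [∀ x, AddCommGroup (U x)]
    [∀ x, Module ℝ (U x)] (𝒱 : VBGroupoid 𝒢 FΓ Γ FE E) {f f' : B → G}
    {a b : TotalSpace FU U → TotalSpace FΓ Γ} (ha : IsFiberwiseLinear f a)
    (hb : IsFiberwiseLinear f' b) (hff' : ∀ x, 𝒢.src (f x) = 𝒢.tgt (f' x))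
    (hab : ∀ p, 𝒱.src (a p) = 𝒱.tgt (b p)) :
    IsFiberwiseLinear (fun x => 𝒢.mul (f x) (f' x)) (fun p => 𝒱.mul (a p) (b p)) := by
  intro x
  obtain ⟨A, hA⟩ := ha x
  obtain ⟨B, hB⟩ := hb x
  obtain ⟨L, hL⟩ := 𝒱.linear_mul (f x) (f' x) (hff' x)
  refine ⟨L.comp (A.prod B), fun u => ?_⟩
  have h := hab ⟨x, u⟩
  simp only [hA, hB] at h ⊢
  exact hL _ _ h

namespace VBGroupoid.Map

variable {φ : VBGroupoid.Map 𝒱' 𝒱}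

/-- Over the unit at `x₀`, the linear map `(v, e') ↦ (s v - φ e', t v)` is surjective when `φ` is
essentially surjective, and a smooth right inverse of it near `x₀` provides a local smooth choice,
linear in `e`, of an object `τ e` and of an arrow `σ e : φ (τ e) → e` over a unit. -/
theorem exists_local_splitting [FiniteDimensional ℝ FΓ] [FiniteDimensional ℝ FE]
    [FiniteDimensional ℝ FE'] (hφ : φ.toMap.IsEssentiallySurjective) (x₀ : M) :
    ∃ (σ : ∀ x, E x →ₗ[ℝ] Γ (𝒢.one x)) (τ : ∀ x, E x →ₗ[ℝ] E' x), ∀ᶠ x in 𝓝 x₀, ∀ e : E x,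
      ContMDiffAt (J.prod 𝓘(ℝ, FE)) (I.prod 𝓘(ℝ, FΓ)) ∞
        (fun p : TotalSpace FE E => (⟨𝒢.one p.1, σ p.1 p.2⟩ : TotalSpace FΓ Γ)) ⟨x, e⟩ ∧
      ContMDiffAt (J.prod 𝓘(ℝ, FE)) (J.prod 𝓘(ℝ, FE')) ∞
        (fun p : TotalSpace FE E => (⟨p.1, τ p.1 p.2⟩ : TotalSpace FE' E')) ⟨x, e⟩ ∧
      𝒱.src ⟨𝒢.one x, σ x e⟩ = φ.obj ⟨x, τ x e⟩ ∧ 𝒱.tgt ⟨𝒢.one x, σ x e⟩ = ⟨x, e⟩ := by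
  obtain ⟨As, hAs, hsA, hds⟩ := 𝒱.linear_src.exists_smooth_matrix 𝒱.src_submersion.contMDiff
    𝒢.src_submersion.contMDiff.continuous (𝒢.src_one x₀)
  obtain ⟨At, hAt, htA, hdt⟩ := 𝒱.linear_tgt.exists_smooth_matrix 𝒱.tgt_submersion.contMDiff
    𝒢.tgt_submersion.contMDiff.continuous (𝒢.tgt_one x₀)
  obtain ⟨Ap, hAp, hpA, hdp⟩ := φ.linear_obj.exists_smooth_matrix φ.contMDiff_obj
    continuous_id (x₀ := x₀) rfl
  have hone : ∀ x, ContMDiffAt J I ∞ 𝒢.one x := fun x => 𝒢.contMDiff_one.contMDiffAt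
  let T : M → FΓ × FE' →L[ℝ] FE × FE := fun x =>
    (ContinuousLinearMap.inl ℝ FE FE).comp ((As (𝒢.one x)).comp (ContinuousLinearMap.fst ℝ FΓ FE')
      - (Ap x).comp (ContinuousLinearMap.snd ℝ FΓ FE'))
    + (ContinuousLinearMap.inr ℝ FE FE).comp
      ((At (𝒢.one x)).comp (ContinuousLinearMap.fst ℝ FΓ FE'))
  have hTapp : ∀ x k l, T x (k, l) = (As (𝒢.one x) k - Ap x l, At (𝒢.one x) k) := by
    intro x k l
    simp [T]
  have hT : ∀ᶠ x in 𝓝 x₀, ContMDiffAt J 𝓘(ℝ, FΓ × FE' →L[ℝ] FE × FE) ∞ T x := by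
    filter_upwards [(hone x₀).continuousAt.eventually hAs,
      (hone x₀).continuousAt.eventually hAt, hAp] with x h1 h2 h3
    have h1' := ContMDiffAt.comp x (g := As) h1 (hone x)
    have h2' := ContMDiffAt.comp x (g := At) h2 (hone x)
    exact (contMDiffAt_const.clm_comp ((h1'.clm_comp contMDiffAt_const).sub
      (h3.clm_comp contMDiffAt_const))).add
      (contMDiffAt_const.clm_comp (h2'.clm_comp contMDiffAt_const))
  have hxE := mem_baseSet_trivializationAt FE E x₀
  -- the source map is split by the units
  have hAs_surj : ∀ w, ∃ k, As (𝒢.one x₀) k = w := by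
    intro w
    let z : TotalSpace FE E := ⟨x₀, (trivializationAt FE E x₀).symm x₀ w⟩
    have h1 : (𝒱.one z).proj = 𝒢.one x₀ := 𝒱.linear_one.proj_eq z
    refine ⟨fiberCoord (𝒢.one x₀) (𝒱.one z), ?_⟩
    have h2 : fiberCoord x₀ (𝒱.src (𝒱.one z))
        = As (𝒢.one x₀) (fiberCoord (𝒢.one x₀) (𝒱.one z)) := by
      generalize 𝒱.one z = y at h1
      obtain ⟨g, v⟩ := y
      cases h1
      exact hsA.self_of_nhds v
    rw [← h2, 𝒱.src_one, fiberCoord_symm hxE]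
  -- the vertical part of the submersion condition at the zero object and its unit
  have hvert : ∀ w, ∃ k l, As (𝒢.one x₀) k = Ap x₀ l ∧ At (𝒢.one x₀) k = w := by
    intro w
    have h1 : 𝒱.one (φ.obj ⟨x₀, 0⟩) = ⟨𝒢.one x₀, 0⟩ := by
      rw [φ.linear_obj.apply_zero, 𝒱.linear_one.apply_zero]
    have h2 := hφ.submersion (𝒱.one (φ.obj ⟨x₀, 0⟩)) ⟨x₀, 0⟩ (𝒱.src_one _)
    rw [h1] at h2
    obtain ⟨u, v, huv, hu⟩ := h2 ((0, w) : EM × FE)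
    let u' : EG × FΓ := u
    let v' : EM × FE' := v
    refine ⟨u'.2, v'.2, ?_, ?_⟩
    · rw [← hds u', ← hdp v']
      exact congrArg Prod.snd huv
    · rw [← hdt u']
      exact congrArg Prod.snd hu
  have hT₀ : Function.Surjective (T x₀) := by
    rintro ⟨w₁, w₂⟩
    obtain ⟨k₁, hk₁⟩ := hAs_surj w₁
    obtain ⟨k₂, l₂, h1, h2⟩ := hvert (w₂ - At (𝒢.one x₀) k₁)
    refine ⟨(k₁ + k₂, l₂), ?_⟩
    rw [hTapp]
    simp [hk₁, h1, h2]
  obtain ⟨R, hR, hTR⟩ := exists_smooth_rightInverse hT hT₀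
  let eE := trivializationAt FE E x₀
  let eE' := trivializationAt FE' E' x₀
  let eΓ := trivializationAt FΓ Γ (𝒢.one x₀)
  let r : M → FE →ₗ[ℝ] FΓ × FE' := fun x => (R x : FE × FE →ₗ[ℝ] FΓ × FE') ∘ₗ LinearMap.inr ℝ FE FE
  refine ⟨fun x => eΓ.symmₗ ℝ (𝒢.one x) ∘ₗ LinearMap.fst ℝ FΓ FE' ∘ₗ r x ∘ₗ eE.linearMapAt ℝ x,
    fun x => eE'.symmₗ ℝ x ∘ₗ LinearMap.snd ℝ FΓ FE' ∘ₗ r x ∘ₗ eE.linearMapAt ℝ x, ?_⟩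
  have hbE := eventually_mem_baseSet (F := FE) (V := E) x₀
  have hbE' := eventually_mem_baseSet (F := FE') (V := E') x₀
  have hbΓ := (hone x₀).continuousAt.eventually
    (eventually_mem_baseSet (F := FΓ) (V := Γ) (𝒢.one x₀))
  have hσ : ∀ x, x ∈ eE.baseSet → 𝒢.one x ∈ eΓ.baseSet → ∀ e : E x,
      (eΓ.symmₗ ℝ (𝒢.one x) ∘ₗ LinearMap.fst ℝ FΓ FE' ∘ₗ r x ∘ₗ eE.linearMapAt ℝ x) e
        = eΓ.symm (𝒢.one x) (R x (0, fiberCoord x₀ (⟨x, e⟩ : TotalSpace FE E))).1 := by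
    intro x hx hx' e
    simp only [LinearMap.comp_apply, eΓ.symmₗ_apply hx', eE.coe_linearMapAt_of_mem hx]
    rfl
  have hτ : ∀ x, x ∈ eE.baseSet → x ∈ eE'.baseSet → ∀ e : E x,
      (eE'.symmₗ ℝ x ∘ₗ LinearMap.snd ℝ FΓ FE' ∘ₗ r x ∘ₗ eE.linearMapAt ℝ x) e
        = eE'.symm x (R x (0, fiberCoord x₀ (⟨x, e⟩ : TotalSpace FE E))).2 := by
    intro x hx hx' e
    simp only [LinearMap.comp_apply, eE'.symmₗ_apply hx', eE.coe_linearMapAt_of_mem hx]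
    rfl
  filter_upwards [hR, hTR, hbE, hbE', hbΓ, hbE.eventually_nhds, hbE'.eventually_nhds,
    hbΓ.eventually_nhds, (hone x₀).continuousAt.eventually hsA,
    (hone x₀).continuousAt.eventually htA, hpA] with x hRx hTRx hx1 hx2 hx3 hn1 hn2 hn3 hs ht hp e
  have hpr : ContMDiff (J.prod 𝓘(ℝ, FE)) J ∞ (TotalSpace.proj : TotalSpace FE E → M) :=
    contMDiff_proj E
  have hprx : ContinuousAt (TotalSpace.proj : TotalSpace FE E → M) ⟨x, e⟩ :=
    hpr.continuous.continuousAt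
  have hRe : ContMDiffAt (J.prod 𝓘(ℝ, FE)) 𝓘(ℝ, FΓ × FE') ∞
      (fun p : TotalSpace FE E => R p.1 (0, fiberCoord x₀ p)) ⟨x, e⟩ :=
    ContMDiffAt.clm_apply (ContMDiffAt.comp (⟨x, e⟩ : TotalSpace FE E) (g := R) hRx hpr.contMDiffAt)
      (contMDiffAt_const.prodMk_space (contMDiffAt_fiberCoord hx1))
  refine ⟨?_, ?_, ?_, ?_⟩
  · have h1 : ContMDiffAt (J.prod 𝓘(ℝ, FE)) 𝓘(ℝ, FΓ) ∞
        (fun p : TotalSpace FE E => (R p.1 (0, fiberCoord x₀ p)).1) ⟨x, e⟩ :=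
      contDiff_fst.contMDiff.contMDiffAt.comp _ hRe
    refine (contMDiffAt_mk_symm (f := fun p : TotalSpace FE E => 𝒢.one p.1) hx3
      ((hone x).comp (⟨x, e⟩ : TotalSpace FE E) hpr.contMDiffAt) h1).congr_of_eventuallyEq ?_
    filter_upwards [hprx.eventually hn1, hprx.eventually hn3] with p h1 h3
    rw [hσ _ h1 h3]
  · have h1 : ContMDiffAt (J.prod 𝓘(ℝ, FE)) 𝓘(ℝ, FE') ∞
        (fun p : TotalSpace FE E => (R p.1 (0, fiberCoord x₀ p)).2) ⟨x, e⟩ :=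
      contDiff_snd.contMDiff.contMDiffAt.comp _ hRe
    refine (contMDiffAt_mk_symm (f := fun p : TotalSpace FE E => p.1) hx2
      hpr.contMDiffAt h1).congr_of_eventuallyEq ?_
    filter_upwards [hprx.eventually hn1, hprx.eventually hn2] with p h1 h3
    rw [hτ _ h1 h3]
  all_goals
    have h1 := hTRx (0, fiberCoord x₀ (⟨x, e⟩ : TotalSpace FE E))
    rw [← Prod.mk.eta (p := R x (0, fiberCoord x₀ (⟨x, e⟩ : TotalSpace FE E))), hTapp] at h1
    have h2 := congrArg Prod.fst h1
    have h3 := congrArg Prod.snd h1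
    simp only at h2 h3
  · have hproj : (𝒱.src ⟨𝒢.one x, (eΓ.symmₗ ℝ (𝒢.one x) ∘ₗ LinearMap.fst ℝ FΓ FE' ∘ₗ r x ∘ₗ
        eE.linearMapAt ℝ x) e⟩).proj = x := by
      rw [𝒱.linear_src.proj_eq]
      exact 𝒢.src_one x
    refine eq_of_fiberCoord_eq (x₀ := x₀) (by rw [hproj]; exact hx1) ?_ ?_
    · rw [hproj, φ.linear_obj.proj_eq]
    · rw [hσ x hx1 hx3, hτ x hx1 hx2, hs, hp, fiberCoord_symm hx3, fiberCoord_symm hx2]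
      exact sub_eq_zero.1 h2
  · have hproj : (𝒱.tgt ⟨𝒢.one x, (eΓ.symmₗ ℝ (𝒢.one x) ∘ₗ LinearMap.fst ℝ FΓ FE' ∘ₗ r x ∘ₗ
        eE.linearMapAt ℝ x) e⟩).proj = x := by
      rw [𝒱.linear_tgt.proj_eq]
      exact 𝒢.tgt_one x
    refine eq_of_fiberCoord_eq (x₀ := x₀) (by rw [hproj]; exact hx1) hproj ?_
    rw [hσ x hx1 hx3, ht, fiberCoord_symm hx3]
    exact h3

/-- The conditions on a local splitting are affine in the pair `(σ, τ)`, so local splittings are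
glued by a partition of unity on `M`. -/
theorem exists_splitting [FiniteDimensional ℝ FΓ] [FiniteDimensional ℝ FE]
    [FiniteDimensional ℝ FE'] [FiniteDimensional ℝ EM] [IsManifold J ∞ M] [T2Space M]
    [SigmaCompactSpace M] (hφ : φ.toMap.IsEssentiallySurjective) :
    ∃ (σ : TotalSpace FE E → TotalSpace FΓ Γ) (τ : TotalSpace FE E → TotalSpace FE' E'),
      ContMDiff (J.prod 𝓘(ℝ, FE)) (I.prod 𝓘(ℝ, FΓ)) ∞ σ ∧ IsFiberwiseLinear 𝒢.one σ ∧
      ContMDiff (J.prod 𝓘(ℝ, FE)) (J.prod 𝓘(ℝ, FE')) ∞ τ ∧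
      IsFiberwiseLinear (fun x : M => x) τ ∧
      (∀ e, 𝒱.src (σ e) = φ.obj (τ e)) ∧ ∀ e, 𝒱.tgt (σ e) = e := by
  choose σ τ h using exists_local_splitting hφ
  choose O hO hOo hxO using fun x₀ => eventually_nhds_iff.1 (h x₀)
  obtain ⟨ρ, hρ⟩ := SmoothPartitionOfUnity.exists_isSubordinate J isClosed_univ O hOo
    (fun x _ => Set.mem_iUnion.2 ⟨x, hxO x⟩)
  let σ' : ∀ x, E x →ₗ[ℝ] Γ (𝒢.one x) := fun x => ∑ i ∈ ρ.finsupport x, ρ i x • σ i x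
  let τ' : ∀ x, E x →ₗ[ℝ] E' x := fun x => ∑ i ∈ ρ.finsupport x, ρ i x • τ i x
  have hσ' : ∀ p : TotalSpace FE E, (⟨𝒢.one p.1, σ' p.1 p.2⟩ : TotalSpace FΓ Γ)
      = ⟨𝒢.one p.1, ∑ i ∈ ρ.finsupport p.1, ρ i p.1 • σ i p.1 p.2⟩ := fun p => by
    simp [σ', LinearMap.sum_apply]
  have hτ' : ∀ p : TotalSpace FE E, (⟨p.1, τ' p.1 p.2⟩ : TotalSpace FE' E')
      = ⟨p.1, ∑ i ∈ ρ.finsupport p.1, ρ i p.1 • τ i p.1 p.2⟩ := fun p => by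
    simp [τ', LinearMap.sum_apply]
  have hmem : ∀ x, ∀ i ∈ ρ.finsupport x, x ∈ O i := fun x i hi =>
    hρ i (subset_tsupport _ (by simpa using hi))
  refine ⟨fun p => ⟨𝒢.one p.1, σ' p.1 p.2⟩, fun p => ⟨p.1, τ' p.1 p.2⟩, ?_,
    fun x => ⟨σ' x, fun _ => rfl⟩, ?_, fun x => ⟨τ' x, fun _ => rfl⟩, ?_, ?_⟩
  · simp only [hσ']
    exact contMDiff_partitionOfUnity_sum ρ hρ 𝒢.contMDiff_one σ
      fun i x hx u => (hO i x hx u).1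
  · simp only [hτ']
    exact contMDiff_partitionOfUnity_sum ρ hρ contMDiff_id τ
      fun i x hx u => (hO i x hx u).2.1
  all_goals
    rintro ⟨x, e⟩
    have hb := mem_baseSet_trivializationAt FE E x
  · have hs : 𝒢.src (𝒢.one x) ∈ (trivializationAt FE E x).baseSet := by rwa [𝒢.src_one]
    refine eq_of_fiberCoord_eq (x₀ := x) (by rw [𝒱.linear_src.proj_eq]; exact hs)
      (by rw [𝒱.linear_src.proj_eq, φ.linear_obj.proj_eq]; exact 𝒢.src_one x) ?_
    refine (congrArg (fun q => fiberCoord x (𝒱.src q)) (hσ' ⟨x, e⟩)).trans (Eq.trans ?_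
      (congrArg (fun q => fiberCoord x (φ.obj q)) (hτ' ⟨x, e⟩)).symm)
    refine (map_sum (𝒱.linear_src.isLinearMap_fiberCoord hs).mk' _ _).trans
      (Eq.trans ?_ (map_sum (φ.linear_obj.isLinearMap_fiberCoord hb).mk' _ _).symm)
    refine Finset.sum_congr rfl fun i hi => ?_
    rw [map_smul, map_smul]
    exact congrArg (fun q => ρ i x • fiberCoord x q) (hO i x (hmem x i hi) e).2.2.1
  · have ht : 𝒢.tgt (𝒢.one x) ∈ (trivializationAt FE E x).baseSet := by rwa [𝒢.tgt_one]
    refine eq_of_fiberCoord_eq (x₀ := x) (by rw [𝒱.linear_tgt.proj_eq]; exact ht)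
      (by rw [𝒱.linear_tgt.proj_eq]; exact 𝒢.tgt_one x) ?_
    refine (congrArg (fun q => fiberCoord x (𝒱.tgt q)) (hσ' ⟨x, e⟩)).trans ?_
    refine (map_sum (𝒱.linear_tgt.isLinearMap_fiberCoord ht).mk' _ _).trans ?_
    let l : Γ (𝒢.one x) →ₗ[ℝ] FE := (𝒱.linear_tgt.isLinearMap_fiberCoord ht).mk'
    have h1 : ∀ i ∈ ρ.finsupport x, l (ρ i x • σ i x e)
        = ρ i x • fiberCoord x (⟨x, e⟩ : TotalSpace FE E) := by
      intro i hi
      rw [map_smul]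
      exact congrArg (fun q => ρ i x • fiberCoord x q) (hO i x (hmem x i hi) e).2.2.2
    refine (Finset.sum_congr rfl h1).trans ?_
    rw [← Finset.sum_smul, ρ.sum_finsupport x (Set.mem_univ x), one_smul]

/-- An arrow of the domain of a fully faithful map is determined by its endpoints and its image. -/
theorem eq_of_isFullyFaithful (hφ : φ.toMap.IsFullyFaithful) {p q : TotalSpace FΓ' Γ'}
    (ht : 𝒱'.tgt p = 𝒱'.tgt q) (hs : 𝒱'.src p = 𝒱'.src q) (h : φ.arr p = φ.arr q) : p = q :=
  hφ.isEmbedding.injective (Prod.ext (Prod.ext ht hs) h)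

variable (φ) in
/-- The fiber coordinates at `g₀` of target, source and image under `φ` of a point of `Γ'`. -/
def jointCoord (g₀ : G) (p : TotalSpace FΓ' Γ') : FE' × FE' × FΓ :=
  (fiberCoord (𝒢.tgt g₀) (𝒱'.tgt p), fiberCoord (𝒢.src g₀) (𝒱'.src p), fiberCoord g₀ (φ.arr p))

theorem isLinearMap_jointCoord {g₀ g : G}
    (ht : 𝒢.tgt g ∈ (trivializationAt FE' E' (𝒢.tgt g₀)).baseSet)
    (hs : 𝒢.src g ∈ (trivializationAt FE' E' (𝒢.src g₀)).baseSet)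
    (hg : g ∈ (trivializationAt FΓ Γ g₀).baseSet) :
    IsLinearMap ℝ (fun v : Γ' g => φ.jointCoord g₀ ⟨g, v⟩) := by
  have h1 := 𝒱'.linear_tgt.isLinearMap_fiberCoord ht
  have h2 := 𝒱'.linear_src.isLinearMap_fiberCoord hs
  have h3 := φ.linear_arr.isLinearMap_fiberCoord hg
  exact ⟨fun v w => Prod.ext (h1.map_add v w) (Prod.ext (h2.map_add v w) (h3.map_add v w)),
    fun c v => Prod.ext (h1.map_smul c v) (Prod.ext (h2.map_smul c v) (h3.map_smul c v))⟩

theorem injective_jointCoord (hφ : φ.toMap.IsFullyFaithful) (g : G) :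
    Function.Injective (fun v : Γ' g => φ.jointCoord g ⟨g, v⟩) := by
  intro v w hvw
  have ht := 𝒱'.linear_tgt.proj_eq
  have hs := 𝒱'.linear_src.proj_eq
  have ha := φ.linear_arr.proj_eq
  have h := eq_of_isFullyFaithful hφ (p := ⟨g, v⟩) (q := ⟨g, w⟩)
    (eq_of_fiberCoord_eq (x₀ := 𝒢.tgt g)
      (by rw [ht]; exact mem_baseSet_trivializationAt FE' E' _) (by rw [ht, ht])
      (congrArg Prod.fst hvw))
    (eq_of_fiberCoord_eq (x₀ := 𝒢.src g)
      (by rw [hs]; exact mem_baseSet_trivializationAt FE' E' _) (by rw [hs, hs])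
      (congrArg (fun q => q.2.1) hvw))
    (eq_of_fiberCoord_eq (x₀ := g)
      (by rw [ha]; exact mem_baseSet_trivializationAt FΓ Γ _) (by rw [ha, ha])
      (congrArg (fun q => q.2.2) hvw))
  exact TotalSpace.mk_inj.1 h

variable {EB : Type*} [NormedAddCommGroup EB] [NormedSpace ℝ EB]
  {HB : Type*} [TopologicalSpace HB] {IB : ModelWithCorners ℝ EB HB}
  {B : Type*} [TopologicalSpace B] [ChartedSpace HB B]
  {FU : Type*} [NormedAddCommGroup FU] [NormedSpace ℝ FU]
  {U : B → Type*} [∀ x, AddCommGroup (U x)] [∀ x, Module ℝ (U x)]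
  [∀ x, TopologicalSpace (U x)] [TopologicalSpace (TotalSpace FU U)]
  [FiberBundle FU U]

/-- Full faithfulness for families: smooth fiberwise linear families of objects `a`, `b` of the
domain and of arrows `c : φ b → φ a` come from a smooth fiberwise linear family of arrows
`b → a`. -/
theorem exists_lift [FiniteDimensional ℝ FΓ'] [FiniteDimensional ℝ FE'] [FiniteDimensional ℝ FΓ]
    (hφ : φ.toMap.IsFullyFaithful) {f : B → G} (hf : ContMDiff IB I ∞ f)
    {a b : TotalSpace FU U → TotalSpace FE' E'} {c : TotalSpace FU U → TotalSpace FΓ Γ}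
    (ha : ContMDiff (IB.prod 𝓘(ℝ, FU)) (J.prod 𝓘(ℝ, FE')) ∞ a)
    (hal : IsFiberwiseLinear (fun x => 𝒢.tgt (f x)) a)
    (hb : ContMDiff (IB.prod 𝓘(ℝ, FU)) (J.prod 𝓘(ℝ, FE')) ∞ b)
    (hbl : IsFiberwiseLinear (fun x => 𝒢.src (f x)) b)
    (hc : ContMDiff (IB.prod 𝓘(ℝ, FU)) (I.prod 𝓘(ℝ, FΓ)) ∞ c) (hcl : IsFiberwiseLinear f c)
    (htc : ∀ p, 𝒱.tgt (c p) = φ.obj (a p)) (hsc : ∀ p, 𝒱.src (c p) = φ.obj (b p)) :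
    ∃ h : TotalSpace FU U → TotalSpace FΓ' Γ',
      ContMDiff (IB.prod 𝓘(ℝ, FU)) (I.prod 𝓘(ℝ, FΓ')) ∞ h ∧ IsFiberwiseLinear f h ∧
      (∀ p, 𝒱'.tgt (h p) = a p) ∧ (∀ p, 𝒱'.src (h p) = b p) ∧ ∀ p, φ.arr (h p) = c p := by
  have hex : ∀ p, ∃ q, 𝒱'.tgt q = a p ∧ 𝒱'.src q = b p ∧ φ.arr q = c p := by
    intro p
    have h1 : ((a p, b p), c p) ∈ Set.range
        (fun x => ((𝒱'.tgt x, 𝒱'.src x), φ.arr x)) := by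
      rw [hφ.range_eq]
      exact Prod.ext (htc p).symm (hsc p).symm
    obtain ⟨q, hq⟩ := h1
    exact ⟨q, congrArg (fun z => z.1.1) hq, congrArg (fun z => z.1.2) hq, congrArg Prod.snd hq⟩
  choose h hht hhs hhc using hex
  have hproj : ∀ p, (h p).proj = f p.proj := fun p => by
    rw [← φ.linear_arr.proj_eq (h p), hhc, hcl.proj_eq]
  have hq : ∀ g p, φ.jointCoord g (h p) = (fiberCoord (𝒢.tgt g) (a p), fiberCoord (𝒢.src g) (b p),
      fiberCoord g (c p)) := fun g p => by rw [jointCoord, hht, hhs, hhc]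
  have htg := 𝒢.tgt_submersion.contMDiff.continuous
  have hsg := 𝒢.src_submersion.contMDiff.continuous
  refine ⟨h, fun p => ?_, ?_, hht, hhs, hhc⟩
  · let g := (h p).proj
    have e1 := htg.continuousAt.eventually (eventually_mem_baseSet (F := FE') (V := E') (𝒢.tgt g))
    have e2 := hsg.continuousAt.eventually (eventually_mem_baseSet (F := FE') (V := E') (𝒢.src g))
    have e3 := eventually_mem_baseSet (F := FΓ) (V := Γ) g
    refine contMDiffAt_of_injective_on_fiber (q := φ.jointCoord g) ?_ ?_
      (injective_jointCoord hφ g) ?_ ?_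
    · filter_upwards [e1, e2, e3] with x h1 h2 h3 using isLinearMap_jointCoord h1 h2 h3
    · filter_upwards [e1, e2, e3] with x h1 h2 h3 v
      have f1 : ContMDiffAt (I.prod 𝓘(ℝ, FΓ')) 𝓘(ℝ, FE') ∞
          (fun p => fiberCoord (𝒢.tgt g) (𝒱'.tgt p)) ⟨x, v⟩ :=
        ContMDiffAt.comp (g := fiberCoord (𝒢.tgt g)) (f := 𝒱'.tgt) (⟨x, v⟩ : TotalSpace FΓ' Γ')
          (contMDiffAt_fiberCoord (IB := J) (by rw [𝒱'.linear_tgt.proj_eq]; exact h1))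
          𝒱'.tgt_submersion.contMDiff.contMDiffAt
      have f2 : ContMDiffAt (I.prod 𝓘(ℝ, FΓ')) 𝓘(ℝ, FE') ∞
          (fun p => fiberCoord (𝒢.src g) (𝒱'.src p)) ⟨x, v⟩ :=
        ContMDiffAt.comp (g := fiberCoord (𝒢.src g)) (f := 𝒱'.src) (⟨x, v⟩ : TotalSpace FΓ' Γ')
          (contMDiffAt_fiberCoord (IB := J) (by rw [𝒱'.linear_src.proj_eq]; exact h2))
          𝒱'.src_submersion.contMDiff.contMDiffAt
      have f3 : ContMDiffAt (I.prod 𝓘(ℝ, FΓ')) 𝓘(ℝ, FΓ) ∞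
          (fun p => fiberCoord g (φ.arr p)) ⟨x, v⟩ :=
        ContMDiffAt.comp (g := fiberCoord g) (f := φ.arr) (⟨x, v⟩ : TotalSpace FΓ' Γ')
          (contMDiffAt_fiberCoord (IB := I) (by rw [φ.linear_arr.proj_eq]; exact h3))
          φ.contMDiff_arr.contMDiffAt
      exact f1.prodMk_space (f2.prodMk_space f3)
    · simp only [hproj]
      exact (hf.comp (contMDiff_proj U)).contMDiffAt
    · have hg : f p.proj = g := (hproj p).symm
      simp only [hq]
      have f1 : ContMDiffAt (IB.prod 𝓘(ℝ, FU)) 𝓘(ℝ, FE') ∞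
          (fun p => fiberCoord (𝒢.tgt g) (a p)) p :=
        ContMDiffAt.comp (g := fiberCoord (𝒢.tgt g)) (f := a) p
          (contMDiffAt_fiberCoord (IB := J)
            (by rw [hal.proj_eq, hg]; exact mem_baseSet_trivializationAt FE' E' _)) ha.contMDiffAt
      have f2 : ContMDiffAt (IB.prod 𝓘(ℝ, FU)) 𝓘(ℝ, FE') ∞
          (fun p => fiberCoord (𝒢.src g) (b p)) p :=
        ContMDiffAt.comp (g := fiberCoord (𝒢.src g)) (f := b) p
          (contMDiffAt_fiberCoord (IB := J)
            (by rw [hbl.proj_eq, hg]; exact mem_baseSet_trivializationAt FE' E' _)) hb.contMDiffAt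
      have f3 : ContMDiffAt (IB.prod 𝓘(ℝ, FU)) 𝓘(ℝ, FΓ) ∞
          (fun p => fiberCoord g (c p)) p :=
        ContMDiffAt.comp (g := fiberCoord g) (f := c) p
          (contMDiffAt_fiberCoord (IB := I)
            (by rw [hcl.proj_eq, hg]; exact mem_baseSet_trivializationAt FΓ Γ _)) hc.contMDiffAt
      exact f1.prodMk_space (f2.prodMk_space f3)
  · refine isFiberwiseLinear_of_injective_on_fiber hproj fun x => ⟨φ.jointCoord (f x),
      isLinearMap_jointCoord (mem_baseSet_trivializationAt FE' E' _)
        (mem_baseSet_trivializationAt FE' E' _) (mem_baseSet_trivializationAt FΓ Γ _),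
      injective_jointCoord hφ (f x), ?_⟩
    simp only [hq]
    have h1 := hal.isLinearMap_fiberCoord (x := x) (mem_baseSet_trivializationAt FE' E' _)
    have h2 := hbl.isLinearMap_fiberCoord (x := x) (mem_baseSet_trivializationAt FE' E' _)
    have h3 := hcl.isLinearMap_fiberCoord (x := x) (mem_baseSet_trivializationAt FΓ Γ _)
    exact ⟨fun v w => Prod.ext (h1.map_add v w) (Prod.ext (h2.map_add v w) (h3.map_add v w)),
      fun k v => Prod.ext (h1.map_smul k v) (Prod.ext (h2.map_smul k v) (h3.map_smul k v))⟩

/-- A quasi-inverse of a Morita VB-map. On objects it is the choice `τ`; the arrows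
`σ e : φ (τ e) → e` form the isomorphism with the identity of `Γ`, and on arrows the
quasi-inverse takes `v` to the arrow of `Γ'` that `φ` maps to `σ(t v)⁻¹ v σ(s v)`. -/
theorem isEquivalence_of_isVBMorita [FiniteDimensional ℝ FΓ] [FiniteDimensional ℝ FE]
    [FiniteDimensional ℝ FΓ'] [FiniteDimensional ℝ FE'] [FiniteDimensional ℝ EM]
    [IsManifold J ∞ M] [T2Space M] [SigmaCompactSpace M] (hφ : φ.IsVBMorita) :
    φ.IsEquivalence := by
  have hff := hφ.fullyFaithful
  obtain ⟨σ, τ, hσ, hσl, hτ, hτl, hsσ, htσ⟩ := exists_splitting hφ.essentiallySurjective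
  have hs := 𝒱.src_submersion.contMDiff
  have ht := 𝒱.tgt_submersion.contMDiff
  have hs' := 𝒱'.src_submersion.contMDiff
  have ht' := 𝒱'.tgt_submersion.contMDiff
  -- the conjugate `σ(t v)⁻¹ v σ(s v)`, an arrow from `φ (τ (s v))` to `φ (τ (t v))`
  let c : TotalSpace FΓ Γ → TotalSpace FΓ Γ := fun v =>
    𝒱.mul (𝒱.mul (𝒱.inv (σ (𝒱.tgt v))) v) (σ (𝒱.src v))
  have hc₁ : ∀ v, 𝒱.src (𝒱.inv (σ (𝒱.tgt v))) = 𝒱.tgt v := fun v => by rw [𝒱.src_inv, htσ]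
  have hc₂ : ∀ v, 𝒱.src (𝒱.mul (𝒱.inv (σ (𝒱.tgt v))) v) = 𝒱.tgt (σ (𝒱.src v)) := fun v => by
    rw [𝒱.src_mul _ _ (hc₁ v), htσ]
  have hct : ∀ v, 𝒱.tgt (c v) = φ.obj (τ (𝒱.tgt v)) := fun v => by
    rw [𝒱.tgt_mul _ _ (hc₂ v), 𝒱.tgt_mul _ _ (hc₁ v), 𝒱.tgt_inv, hsσ]
  have hcs : ∀ v, 𝒱.src (c v) = φ.obj (τ (𝒱.src v)) := fun v => by
    rw [𝒱.src_mul _ _ (hc₂ v), hsσ]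
  have hσc : ∀ v, 𝒱.mul (σ (𝒱.tgt v)) (c v) = 𝒱.mul v (σ (𝒱.src v)) := fun v => by
    have h1 : 𝒱.tgt (σ (𝒱.tgt v)) = 𝒱.tgt v := htσ _
    have h2 : 𝒱.src (σ (𝒱.tgt v)) = 𝒱.tgt (𝒱.mul (𝒱.inv (σ (𝒱.tgt v))) v) := by
      rw [𝒱.tgt_mul _ _ (hc₁ v), 𝒱.tgt_inv]
    rw [← 𝒱.mul_assoc _ _ _ h2 (hc₂ v), 𝒱.mul_inv_cancel_left h1]
  have hc : ContMDiff (I.prod 𝓘(ℝ, FΓ)) (I.prod 𝓘(ℝ, FΓ)) ∞ c :=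
    𝒱.contMDiff_mul_comp (𝒱.contMDiff_mul_comp (𝒱.contMDiff_inv.comp (hσ.comp ht)) contMDiff_id hc₁)
      (hσ.comp hs) hc₂
  have hcl : IsFiberwiseLinear (fun g : G => g) c := by
    have h1 := 𝒱.isFiberwiseLinear_mul
      (𝒱.isFiberwiseLinear_mul (𝒱.linear_inv.comp (hσl.comp 𝒱.linear_tgt)) isFiberwiseLinear_id
        (fun g => by rw [𝒢.src_inv, 𝒢.tgt_one]) hc₁)
      (hσl.comp 𝒱.linear_src)
      (fun g => by rw [𝒢.src_mul _ _ (by rw [𝒢.src_inv, 𝒢.tgt_one]), 𝒢.tgt_one]) hc₂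
    have h2 : (fun g => 𝒢.mul (𝒢.mul (𝒢.inv (𝒢.one (𝒢.tgt g))) g) (𝒢.one (𝒢.src g)))
        = fun g => g := by
      funext g
      rw [𝒢.inv_one, 𝒢.one_mul, 𝒢.mul_one]
    rwa [h2] at h1
  obtain ⟨ψ, hψ, hψl, hψt, hψs, hψφ⟩ := exists_lift hff contMDiff_id (hτ.comp ht)
    (hτl.comp 𝒱.linear_tgt) (hτ.comp hs) (hτl.comp 𝒱.linear_src) hc hcl hct hcs
  simp only [Function.comp_apply] at hψt hψs
  let Ψ : VBGroupoid.Map 𝒱 𝒱' :=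
    { arr := ψ
      obj := τ
      contMDiff_arr := hψ
      contMDiff_obj := hτ
      src_arr := hψs
      tgt_arr := hψt
      arr_mul := fun v w hvw => by
        have h : 𝒱'.src (ψ v) = 𝒱'.tgt (ψ w) := by rw [hψs, hψt, hvw]
        have hcc : 𝒱.src (c v) = 𝒱.tgt (c w) := by rw [hcs, hct, hvw]
        refine eq_of_isFullyFaithful hff ?_ ?_ ?_
        · rw [hψt, 𝒱'.tgt_mul _ _ h, hψt, 𝒱.tgt_mul _ _ hvw]
        · rw [hψs, 𝒱'.src_mul _ _ h, hψs, 𝒱.src_mul _ _ hvw]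
        · rw [hψφ, φ.arr_mul _ _ h, hψφ, hψφ]
          refine 𝒱.mul_left_cancel (g := σ (𝒱.tgt (𝒱.mul v w))) (by rw [hsσ, hct])
            (by rw [𝒱.tgt_mul _ _ hcc, hsσ, hct, 𝒱.tgt_mul _ _ hvw]) ?_
          have h1 : 𝒱.src (σ (𝒱.tgt v)) = 𝒱.tgt (c v) := by rw [hsσ, hct]
          have h2 : 𝒱.src v = 𝒱.tgt (σ (𝒱.src v)) := by rw [htσ]
          have h3 : 𝒱.src (σ (𝒱.src v)) = 𝒱.tgt (c w) := by rw [hsσ, hct, hvw]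
          have h4 : 𝒱.src w = 𝒱.tgt (σ (𝒱.src w)) := by rw [htσ]
          rw [hσc, 𝒱.tgt_mul _ _ hvw, 𝒱.src_mul _ _ hvw, ← 𝒱.mul_assoc _ _ _ h1 hcc, hσc,
            𝒱.mul_assoc _ _ _ h2 h3, hvw, hσc, 𝒱.mul_assoc _ _ _ hvw h4]
      arr_one := fun e => by
        refine eq_of_isFullyFaithful hff ?_ ?_ ?_
        · rw [hψt, 𝒱.tgt_one, 𝒱'.tgt_one]
        · rw [hψs, 𝒱.src_one, 𝒱'.src_one]
        · rw [hψφ, φ.arr_one]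
          simp only [c]
          rw [𝒱.tgt_one, 𝒱.src_one]
          have h1 := 𝒱.mul_one (𝒱.inv (σ e))
          rw [𝒱.src_inv, htσ] at h1
          rw [h1, 𝒱.inv_mul, hsσ]
      arr_inv := fun v => by
        have h1 : 𝒱'.src (ψ v) = 𝒱'.tgt (ψ (𝒱.inv v)) := by rw [hψs, hψt, 𝒱.tgt_inv]
        have h2 : 𝒱'.src (ψ v) = 𝒱'.tgt (𝒱'.inv (ψ v)) := (𝒱'.tgt_inv _).symm
        refine eq_of_isFullyFaithful hff (h1.symm.trans h2) ?_ ?_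
        · rw [hψs, 𝒱'.src_inv, hψt, 𝒱.src_inv]
        · rw [hψφ, φ.arr_inv, hψφ]
          have h3 : 𝒱.src (c v) = 𝒱.tgt (c (𝒱.inv v)) := by rw [hcs, hct, 𝒱.tgt_inv]
          refine 𝒱.mul_left_cancel h3 (𝒱.tgt_inv _).symm ?_
          have h4 : 𝒱.src (σ (𝒱.tgt v)) = 𝒱.tgt (c v) := by rw [hsσ, hct]
          refine 𝒱.mul_left_cancel (g := σ (𝒱.tgt v)) (by rw [𝒱.tgt_mul _ _ h3, h4])
            (by rw [𝒱.tgt_mul _ _ (𝒱.tgt_inv _).symm, h4]) ?_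
          have h5 : 𝒱.src v = 𝒱.tgt (σ (𝒱.src v)) := (htσ _).symm
          have h6 : 𝒱.src (σ (𝒱.src v)) = 𝒱.tgt (c (𝒱.inv v)) := by
            rw [hsσ, hct, 𝒱.tgt_inv]
          have h7 := hσc (𝒱.inv v)
          rw [𝒱.tgt_inv, 𝒱.src_inv] at h7
          have h8 : 𝒱.src (𝒱.inv v) = 𝒱.tgt (σ (𝒱.tgt v)) := by rw [𝒱.src_inv, htσ]
          rw [← 𝒱.mul_assoc _ _ _ h4 h3, hσc, 𝒱.mul_assoc _ _ _ h5 h6, h7,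
            ← 𝒱.mul_assoc _ _ _ (𝒱.tgt_inv v).symm h8, 𝒱.mul_inv, 𝒱.mul_inv, ← h4]
          have h9 := 𝒱.one_mul (σ (𝒱.tgt v))
          rw [htσ] at h9
          rw [h9, 𝒱.mul_one]
      linear_arr := hψl
      linear_obj := hτl }
  -- the isomorphism `ψ φ ≅ id` is the lift of `σ φ`
  obtain ⟨β, hβ, hβl, hβt, hβs, hβφ⟩ := exists_lift (U := E') (c := fun e => σ (φ.obj e))
    (a := fun e => e) (b := fun e => τ (φ.obj e)) hff 𝒢.contMDiff_one contMDiff_id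
    (by simpa only [𝒢.tgt_one] using isFiberwiseLinear_id) (hτ.comp φ.contMDiff_obj)
    (by simpa only [𝒢.src_one] using hτl.comp φ.linear_obj)
    (hσ.comp φ.contMDiff_obj) (hσl.comp φ.linear_obj)
    (fun e => htσ _) (fun e => hsσ _)
  refine ⟨Ψ, ⟨⟨β, hβ, hβl, hβs, hβt, fun v => ?_⟩⟩, ⟨⟨σ, hσ, hσl, hsσ, htσ, fun v => ?_⟩⟩⟩
  · change 𝒱'.mul v (β (𝒱'.src v)) = 𝒱'.mul (β (𝒱'.tgt v)) (ψ (φ.arr v))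
    have h1 : 𝒱'.src v = 𝒱'.tgt (β (𝒱'.src v)) := (hβt _).symm
    have h2 : 𝒱'.src (β (𝒱'.tgt v)) = 𝒱'.tgt (ψ (φ.arr v)) := by rw [hβs, hψt, φ.tgt_arr]
    refine eq_of_isFullyFaithful hff ?_ ?_ ?_
    · rw [𝒱'.tgt_mul _ _ h1, 𝒱'.tgt_mul _ _ h2, hβt]
    · rw [𝒱'.src_mul _ _ h1, 𝒱'.src_mul _ _ h2, hβs, hψs, φ.src_arr]
    · rw [φ.arr_mul _ _ h1, φ.arr_mul _ _ h2, hβφ, hβφ, hψφ, ← φ.tgt_arr, ← φ.src_arr, hσc]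
  · change 𝒱.mul v (σ (𝒱.src v)) = 𝒱.mul (σ (𝒱.tgt v)) (φ.arr (ψ v))
    rw [hψφ, hσc]

/-- The isomorphisms of an equivalence of VB-groupoids are natural isomorphisms of Lie groupoid
maps, so the criterion for Lie groupoids applies. -/
theorem isVBMorita_of_isEquivalence [I.Boundaryless] [J.Boundaryless]
    [FiniteDimensional ℝ EG] [FiniteDimensional ℝ EM] [FiniteDimensional ℝ FΓ]
    [FiniteDimensional ℝ FE] [FiniteDimensional ℝ FE'] (hφ : φ.IsEquivalence) : φ.IsVBMorita := by
  obtain ⟨ψ, ⟨α⟩, ⟨β⟩⟩ := hφ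
  exact LieGroupoid.Map.isMorita_of_isoId (ψ := ψ.toMap)
    ⟨α.app, α.contMDiff_app, α.src_app, α.tgt_app, α.naturality⟩
    ⟨β.app, β.contMDiff_app, β.src_app, β.tgt_app, β.naturality⟩

end VBGroupoid.Map
end VBGroupoids

theorem mainTheorem5
    {EG : Type*} [NormedAddCommGroup EG] [NormedSpace ℝ EG] [FiniteDimensional ℝ EG]
    {EM : Type*} [NormedAddCommGroup EM] [NormedSpace ℝ EM] [FiniteDimensional ℝ EM]
    {G : Type*} [TopologicalSpace G] [ChartedSpace EG G] [IsManifold 𝓘(ℝ, EG) ∞ G]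
    [T2Space G] [SecondCountableTopology G]
    {M : Type*} [TopologicalSpace M] [ChartedSpace EM M] [IsManifold 𝓘(ℝ, EM) ∞ M]
    [T2Space M] [SecondCountableTopology M]
    (𝒢 : LieGroupoid 𝓘(ℝ, EG) 𝓘(ℝ, EM) G M)
    {FΓ' : Type*} [NormedAddCommGroup FΓ'] [NormedSpace ℝ FΓ'] [FiniteDimensional ℝ FΓ']
    {Γ' : G → Type*} [∀ g, AddCommGroup (Γ' g)] [∀ g, Module ℝ (Γ' g)]
    [∀ g, TopologicalSpace (Γ' g)] [TopologicalSpace (TotalSpace FΓ' Γ')]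
    [FiberBundle FΓ' Γ'] [VectorBundle ℝ FΓ' Γ'] [ContMDiffVectorBundle ∞ FΓ' Γ' 𝓘(ℝ, EG)]
    {FE' : Type*} [NormedAddCommGroup FE'] [NormedSpace ℝ FE'] [FiniteDimensional ℝ FE']
    {E' : M → Type*} [∀ x, AddCommGroup (E' x)] [∀ x, Module ℝ (E' x)]
    [∀ x, TopologicalSpace (E' x)] [TopologicalSpace (TotalSpace FE' E')]
    [FiberBundle FE' E'] [VectorBundle ℝ FE' E'] [ContMDiffVectorBundle ∞ FE' E' 𝓘(ℝ, EM)]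
    {FΓ : Type*} [NormedAddCommGroup FΓ] [NormedSpace ℝ FΓ] [FiniteDimensional ℝ FΓ]
    {Γ : G → Type*} [∀ g, AddCommGroup (Γ g)] [∀ g, Module ℝ (Γ g)]
    [∀ g, TopologicalSpace (Γ g)] [TopologicalSpace (TotalSpace FΓ Γ)]
    [FiberBundle FΓ Γ] [VectorBundle ℝ FΓ Γ] [ContMDiffVectorBundle ∞ FΓ Γ 𝓘(ℝ, EG)]
    {FE : Type*} [NormedAddCommGroup FE] [NormedSpace ℝ FE] [FiniteDimensional ℝ FE]
    {E : M → Type*} [∀ x, AddCommGroup (E x)] [∀ x, Module ℝ (E x)]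
    [∀ x, TopologicalSpace (E x)] [TopologicalSpace (TotalSpace FE E)]
    [FiberBundle FE E] [VectorBundle ℝ FE E] [ContMDiffVectorBundle ∞ FE E 𝓘(ℝ, EM)]
    (𝒱' : VBGroupoid 𝒢 FΓ' Γ' FE' E') (𝒱 : VBGroupoid 𝒢 FΓ Γ FE E)
    (φ : VBGroupoid.Map 𝒱' 𝒱) :
    φ.IsVBMorita ↔ φ.IsEquivalence := by
  have : LocallyCompactSpace M := ChartedSpace.locallyCompactSpace EM M
  exact ⟨VBGroupoid.Map.isEquivalence_of_isVBMorita, VBGroupoid.Map.isVBMorita_of_isEquivalence⟩
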